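/- Let $K$ be a field of prime characteristic $p>0$, and let $\Xi=(S_n,R_n\mid n\ge 0)$ be an arbitrary tuple of positive integers. Let $R(\Xi)$ be the divided power algebra in the variables $x_n,y_n,z_n$ ($n\ge 0$): it has the $K$-basis of formal symbols $$\prod_{n\ge 0} x_n^{(\alpha_n)}y_n^{(\beta_n)}z_n^{(\gamma_n)},\qquad 0\le\alpha_n<p^{S_n},\ 0\le\beta_n,\gamma_n<p^{R_n},$$ with only finitely many nonzero exponents, and the product determined, variable by variable, by $t^{(i)}t^{(j)}=\binom{i+j}{i}t^{(i+j)}$ (which is $0$ when $i+j$ exceeds the allowed range). Let $\partial_{x_n},\partial_{y_n},\partial_{z_n}$ be the derivations of $R(\Xi)$ that lower by one the exponent of the respective variable, and let $v_i,w_i,u_i\in\operatorname{Der}R(\Xi)$, $i\ge 0$, be given by $$v_i=\partial_{x_i}+x_i^{(p^{S_i}-1)}y_i^{(p^{R_i}-1)}v_{i+1},\quad w_i=\partial_{y_i}+y_i^{(p^{R_i}-1)}x_i^{(p^{S_i}-1)}w_{i+1},\quad u_i=\partial_{z_i}+z_i^{(p^{R_i}-1)}x_i^{(p^{S_i}-1)}u_{i+1},$$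 that is, by the infinite sums obtained by expanding these recursions, for instance $v_i=\sum_{j\ge i}\bigl(\prod_{k=i}^{j-1}x_k^{(p^{S_k}-1)}y_k^{(p^{R_k}-1)}\bigr)\partial_{x_j}$. For a set $X\subset\operatorname{Der}R(\Xi)$ let $\operatorname{Lie}_p(X)$ be the smallest Lie subalgebra of $\operatorname{Der}R(\Xi)$ that contains $X$ and is closed under $D\mapsto D^p$. The clover restricted Lie algebra is $\mathbf T(\Xi)=\operatorname{Lie}_p(v_0,w_0,u_0)$. For a finite generating set $X$ of $\mathbf T(\Xi)$, i.e. $\operatorname{Lie}_p(X)=\mathbf T(\Xi)$, let $\gamma(X,n)$ be the dimension of the $K$-span of all elements $[x_1,[x_2,\dots,[x_{s-1},x_s]\dots]]^{p^k}$ with $x_i\in X$, $s\ge 1$, $k\ge 0$ and $sp^k\le n$, and put $\operatorname{GKdim}\mathbf T(\Xi)=\limsup_{n\to\infty}\ln\gamma(X,n)/\ln n$. Then $1\le\operatorname{GKdim}\mathbf T(\Xi)\le 3$, whichever finite generating set $X$ is used. -/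

import Mathlib

/-! ## Divided power algebras -/

/-- Exponents of the basis monomials `∏ t_a^(i_a)`: finitely supported, with `i_a < p ^ s a`. -/
abbrev DPIndex {Θ : Type*} (p : ℕ) (s : Θ → ℕ) : Type _ :=
  {i : Θ →₀ ℕ // ∀ a, i a < p ^ s a}

/-- The divided power algebra `R(Θ, s)` over `K`: the `K`-vector space whose basis consists of the
formal symbols `∏ t_a^(i_a)`, `0 ≤ i_a < p ^ s a`. -/
def DPAlg (K : Type*) [Field K] {Θ : Type*} (p : ℕ) (s : Θ → ℕ) : Type _ :=
  DPIndex p s →₀ K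

namespace DPAlg

section Basic

variable {K : Type*} [Field K] {Θ : Type*} {p : ℕ} {s : Θ → ℕ}

noncomputable instance : AddCommGroup (DPAlg K p s) :=
  inferInstanceAs (AddCommGroup (DPIndex p s →₀ K))

noncomputable instance : Module K (DPAlg K p s) :=
  inferInstanceAs (Module K (DPIndex p s →₀ K))

open Classical in
/-- The monomial `∏ t_a^(i_a)`; it is zero as soon as some exponent `i_a` is at least `p ^ s a`. -/
noncomputable def mono (i : Θ →₀ ℕ) : DPAlg K p s :=
  if h : ∀ a, i a < p ^ s a then Finsupp.single (⟨i, h⟩ : DPIndex p s) (1 : K) else 0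

theorem mono_eq_single (i : Θ →₀ ℕ) (h : ∀ a, i a < p ^ s a) :
    (mono i : DPAlg K p s) = Finsupp.single (⟨i, h⟩ : DPIndex p s) (1 : K) :=
  dif_pos h

/-- The linear map with prescribed values on the basis of monomials. -/
noncomputable def lin {M : Type*} [AddCommGroup M] [Module K M] (f : (Θ →₀ ℕ) → M) :
    DPAlg K p s →ₗ[K] M :=
  Finsupp.linearCombination K (fun i : DPIndex p s => f i.1)

theorem lin_mono {M : Type*} [AddCommGroup M] [Module K M] (f : (Θ →₀ ℕ) → M) (i : Θ →₀ ℕ)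
    (h : ∀ a, i a < p ^ s a) : lin f (mono i : DPAlg K p s) = f i := by
  rw [mono_eq_single i h]
  exact (Finsupp.linearCombination_single K (1 : K) (⟨i, h⟩ : DPIndex p s)).trans (one_smul _ _)

theorem mono_eq_zero (i : Θ →₀ ℕ) (h : ¬ ∀ a, i a < p ^ s a) : (mono i : DPAlg K p s) = 0 :=
  dif_neg h

theorem lin_ext {M : Type*} [AddCommGroup M] [Module K M] {f g : DPAlg K p s →ₗ[K] M}
    (h : ∀ i : Θ →₀ ℕ, (∀ a, i a < p ^ s a) → f (mono i) = g (mono i)) : f = g := by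
  refine Finsupp.lhom_ext' (R := K) (α := DPIndex p s) (M := K) (N := M) fun i => ?_
  refine LinearMap.ext_ring ?_
  have e := mono_eq_single (K := K) i.1 i.2
  exact (congrArg f e).symm.trans ((h i.1 i.2).trans (congrArg g e))

/-- The product of binomial coefficients `∏_a (i_a + j_a choose i_a)`. -/
def binom (i j : Θ →₀ ℕ) : ℕ := ∏ a ∈ i.support, (i a + j a).choose (i a)

theorem binom_eq (i j : Θ →₀ ℕ) (t : Finset Θ) (ht : i.support ⊆ t) :
    binom i j = ∏ a ∈ t, (i a + j a).choose (i a) := by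
  refine Finset.prod_subset ht fun a _ ha => ?_
  rw [Finsupp.notMem_support_iff.mp ha, Nat.choose_zero_right]

theorem binom_comm (i j : Θ →₀ ℕ) : binom i j = binom j i := by
  classical
  rw [binom_eq i j (i.support ∪ j.support) Finset.subset_union_left,
    binom_eq j i (i.support ∪ j.support) Finset.subset_union_right]
  refine Finset.prod_congr rfl fun a _ => ?_
  rw [add_comm (j a), ← Nat.choose_symm_add]

theorem binom_assoc (i j k : Θ →₀ ℕ) :
    binom i j * binom (i + j) k = binom j k * binom i (j + k) := by
  classical
  set t := i.support ∪ j.support with ht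
  have hi : i.support ⊆ t := Finset.subset_union_left
  have hj : j.support ⊆ t := Finset.subset_union_right
  rw [binom_eq i j t hi, binom_eq (i + j) k t Finsupp.support_add, binom_eq j k t hj,
    binom_eq i (j + k) t hi, ← Finset.prod_mul_distrib, ← Finset.prod_mul_distrib]
  refine Finset.prod_congr rfl fun a _ => ?_
  simp only [Finsupp.add_apply]
  have h := Nat.choose_mul (n := i a + j a + k a) (k := i a + j a) (s := i a) (by omega)
  have e1 : i a + j a + k a - i a = j a + k a := by omega
  have e2 : i a + j a - i a = j a := by omega
  rw [e1, e2] at h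
  rw [mul_comm, h, mul_comm, add_assoc]

/-- The multiplication: `t^(i) * t^(j) = ∏_a (i_a + j_a choose i_a) t^(i + j)`. -/
noncomputable def mulLin : DPAlg K p s →ₗ[K] DPAlg K p s →ₗ[K] DPAlg K p s :=
  lin fun i => lin fun j => (binom i j : K) • mono (i + j)

noncomputable instance : Mul (DPAlg K p s) := ⟨fun f g => mulLin f g⟩

theorem mulLin_apply (f g : DPAlg K p s) : mulLin f g = f * g := rfl

theorem mono_mul_mono (i j : Θ →₀ ℕ) (hi : ∀ a, i a < p ^ s a) (hj : ∀ a, j a < p ^ s a) :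
    (mono i * mono j : DPAlg K p s) = (binom i j : K) • mono (i + j) := by
  rw [← mulLin_apply, mulLin, lin_mono _ _ hi, lin_mono _ _ hj]

protected theorem mul_comm' (f g : DPAlg K p s) : f * g = g * f := by
  have : (mulLin : DPAlg K p s →ₗ[K] DPAlg K p s →ₗ[K] DPAlg K p s) = mulLin.flip := by
    refine lin_ext fun i hi => lin_ext fun j hj => ?_
    rw [LinearMap.flip_apply, mulLin_apply, mulLin_apply, mono_mul_mono i j hi hj,
      mono_mul_mono j i hj hi, binom_comm, add_comm]
  exact LinearMap.congr_fun₂ this f g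

theorem mul_mono_aux (i j k : Θ →₀ ℕ) (hk : ∀ a, k a < p ^ s a) :
    mulLin (mono (i + j) : DPAlg K p s) (mono k) = (binom (i + j) k : K) • mono (i + j + k) := by
  by_cases h : ∀ a, (i + j) a < p ^ s a
  · exact mono_mul_mono _ _ h hk
  · rw [mono_eq_zero _ h, mono_eq_zero (i + j + k), map_zero, LinearMap.zero_apply, smul_zero]
    intro h'
    exact h fun a => lt_of_le_of_lt (Nat.le_add_right _ _) (h' a)

protected theorem mul_assoc' (f g h : DPAlg K p s) : f * g * h = f * (g * h) := by
  have key : ∀ f g : DPAlg K p s, mulLin (mulLin f g) = mulLin f ∘ₗ mulLin g := by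
    have : (LinearMap.llcomp K (DPAlg K p s) (DPAlg K p s) _ mulLin) ∘ₗ mulLin
        = (LinearMap.lcomp K _ mulLin) ∘ₗ
          (LinearMap.llcomp K (DPAlg K p s) (DPAlg K p s) (DPAlg K p s)) ∘ₗ mulLin := by
      refine lin_ext fun i hi => lin_ext fun j hj => lin_ext fun k hk => ?_
      simp only [LinearMap.comp_apply, LinearMap.llcomp_apply, LinearMap.lcomp_apply]
      rw [mulLin_apply (mono i) (mono j), mulLin_apply (mono j) (mono k),
        mono_mul_mono i j hi hj, mono_mul_mono j k hj hk, map_smul, map_smul,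
        LinearMap.smul_apply, mul_mono_aux i j k hk, mulLin_apply, DPAlg.mul_comm',
        ← mulLin_apply, mul_mono_aux j k i hi, smul_smul, smul_smul, binom_comm (j + k) i,
        ← Nat.cast_mul, ← Nat.cast_mul, binom_assoc, add_comm (j + k) i, add_assoc]
    intro f g
    exact LinearMap.congr_fun₂ this f g
  exact LinearMap.congr_fun (key f g) h

variable [hp : Fact p.Prime]

protected theorem one_mul' (f : DPAlg K p s) : mono 0 * f = f := by
  have h0 : ∀ a, (0 : Θ →₀ ℕ) a < p ^ s a := fun a => pow_pos hp.out.pos _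
  have : mulLin (mono 0 : DPAlg K p s) = LinearMap.id := by
    refine lin_ext fun i hi => ?_
    rw [mulLin_apply, mono_mul_mono 0 i h0 hi, LinearMap.id_apply, zero_add]
    simp [binom]
  exact LinearMap.congr_fun this f

noncomputable instance : CommRing (DPAlg K p s) :=
  { (inferInstance : AddCommGroup (DPAlg K p s)),
    (inferInstance : Mul (DPAlg K p s)) with
    one := mono 0
    one_mul := DPAlg.one_mul'
    mul_one := fun f => (DPAlg.mul_comm' f _).trans (DPAlg.one_mul' f)
    mul_assoc := DPAlg.mul_assoc'
    mul_comm := DPAlg.mul_comm'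
    left_distrib := fun f g h => map_add (mulLin f) g h
    right_distrib := fun f g h => LinearMap.map_add₂ mulLin f g h
    zero_mul := fun f => LinearMap.map_zero₂ mulLin f
    mul_zero := fun f => map_zero (mulLin f) }

noncomputable instance : Algebra K (DPAlg K p s) :=
  Algebra.ofModule (fun c f g => LinearMap.map_smul₂ mulLin c f g)
    (fun c f g => map_smul (mulLin f) c g)

end Basic

section Derivations

variable {K : Type*} [Field K] {Θ : Type*} {p : ℕ} {s : Θ → ℕ}

open Classical in
/-- `∂_a` as a linear map: it lowers the exponent of `t_a` by one, and kills the monomials that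
do not contain `t_a`. -/
noncomputable def partialLin (a : Θ) : DPAlg K p s →ₗ[K] DPAlg K p s :=
  lin fun i => if i a = 0 then 0 else mono (i - Finsupp.single a 1)

open Classical in
theorem partialLin_mono (a : Θ) (i : Θ →₀ ℕ) (hi : ∀ b, i b < p ^ s b) :
    partialLin a (mono i : DPAlg K p s)
      = if i a = 0 then 0 else mono (i - Finsupp.single a 1) :=
  lin_mono _ _ hi

theorem partialLin_eq_zero (a : Θ) (i : Θ →₀ ℕ) (ha : i a = 0) :
    partialLin a (mono i : DPAlg K p s) = 0 := by
  by_cases hi : ∀ b, i b < p ^ s b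
  · rw [partialLin_mono a i hi, if_pos ha]
  · rw [mono_eq_zero i hi, map_zero]

theorem partialLin_of_ne (a : Θ) (i : Θ →₀ ℕ) (hi : ∀ b, i b < p ^ s b) (ha : i a ≠ 0) :
    partialLin a (mono i : DPAlg K p s) = mono (i - Finsupp.single a 1) := by
  rw [partialLin_mono a i hi, if_neg ha]

theorem binom_split (a : Θ) (i j : Θ →₀ ℕ) :
    binom i j = (i a + j a).choose (i a) * binom (i.erase a) (j.erase a) := by
  classical
  rw [binom_eq i j (insert a i.support) (Finset.subset_insert _ _),
    binom_eq (i.erase a) (j.erase a) (insert a i.support)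
      (by rw [Finsupp.support_erase]
          exact (Finset.erase_subset _ _).trans (Finset.subset_insert _ _)),
    ← Finset.mul_prod_erase _ _ (Finset.mem_insert_self a i.support),
    ← Finset.mul_prod_erase (insert a i.support)
      (fun b => ((i.erase a) b + (j.erase a) b).choose ((i.erase a) b))
      (Finset.mem_insert_self a i.support)]
  simp only [Finsupp.erase_same, Nat.choose_zero_right, one_mul]
  congr 1
  refine Finset.prod_congr rfl fun b hb => ?_
  have hba : b ≠ a := Finset.ne_of_mem_erase hb
  rw [Finsupp.erase_ne hba, Finsupp.erase_ne hba]

theorem erase_sub_single (a : Θ) (i : Θ →₀ ℕ) :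
    (i - Finsupp.single a 1).erase a = i.erase a := by
  classical
  ext b
  by_cases hb : b = a
  · subst hb
    simp
  · rw [Finsupp.erase_ne hb, Finsupp.erase_ne hb, Finsupp.tsub_apply,
      Finsupp.single_eq_of_ne hb, Nat.sub_zero]

theorem lt_of_sub_single (a : Θ) (i : Θ →₀ ℕ) (hi : ∀ b, i b < p ^ s b) :
    ∀ b, (i - Finsupp.single a 1 : Θ →₀ ℕ) b < p ^ s b :=
  fun b => lt_of_le_of_lt (Nat.sub_le _ _) (hi b)

theorem sub_single_add (a : Θ) (i j : Θ →₀ ℕ) (hi : i a ≠ 0) :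
    i - Finsupp.single a 1 + j = i + j - Finsupp.single a 1 := by
  classical
  ext b
  by_cases hb : b = a
  · subst hb
    simp only [Finsupp.add_apply, Finsupp.tsub_apply, Finsupp.single_eq_same]
    omega
  · simp [Finsupp.single_eq_of_ne hb]

theorem add_sub_single (a : Θ) (i j : Θ →₀ ℕ) (hj : j a ≠ 0) :
    i + (j - Finsupp.single a 1) = i + j - Finsupp.single a 1 := by
  rw [add_comm, sub_single_add a j i hj, add_comm i j]

theorem sub_single_same (a : Θ) (i : Θ →₀ ℕ) : (i - Finsupp.single a 1 : Θ →₀ ℕ) a = i a - 1 := by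
  simp

variable [hp : Fact p.Prime]

theorem leibniz_of_mono (D : DPAlg K p s →ₗ[K] DPAlg K p s)
    (h : ∀ i j : Θ →₀ ℕ, (∀ b, i b < p ^ s b) → (∀ b, j b < p ^ s b) →
      D (mono i * mono j) = mono i * D (mono j) + mono j * D (mono i))
    (f g : DPAlg K p s) : D (f * g) = f • D g + g • D f := by
  have : LinearMap.compr₂ (LinearMap.mul K (DPAlg K p s)) D
      = LinearMap.compl₂ (LinearMap.mul K (DPAlg K p s)) D
        + (LinearMap.compl₂ (LinearMap.mul K (DPAlg K p s)) D).flip :=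
    lin_ext fun i hi => lin_ext fun j hj => h i j hi hj
  exact LinearMap.congr_fun₂ this f g

variable [CharP K p]

theorem partialLin_mul_mono (a : Θ) (i j : Θ →₀ ℕ) (hi : ∀ b, i b < p ^ s b)
    (hj : ∀ b, j b < p ^ s b) (h0 : (i + j) a ≠ 0) :
    (binom i j : K) • partialLin a (mono (i + j) : DPAlg K p s)
      = (binom i j : K) • mono (i + j - Finsupp.single a 1) := by
  by_cases h : ∀ b, (i + j) b < p ^ s b
  · rw [partialLin_of_ne a _ h h0]
  · rw [mono_eq_zero _ h, map_zero, smul_zero]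
    by_cases h' : ∀ b, (i + j - Finsupp.single a 1 : Θ →₀ ℕ) b < p ^ s b
    · have hne : ∀ b, b ≠ a → (i + j) b < p ^ s b := by
        intro b hb
        have := h' b
        rwa [Finsupp.tsub_apply, Finsupp.single_eq_of_ne hb, Nat.sub_zero] at this
      have ha : (i + j) a = p ^ s a := by
        have h1 := h' a
        rw [sub_single_same] at h1
        have h2 : ¬ (i + j) a < p ^ s a := by
          intro h3
          refine h fun b => ?_
          by_cases hb : b = a
          · rw [hb]; exact h3
          · exact hne b hb
        omega
      have ha' : i a + j a = p ^ s a := ha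
      have h1 := hi a
      have h2 := hj a
      have hdvd : p ∣ binom i j := by
        rw [binom_split a, ha']
        exact (hp.out.dvd_choose_pow (by omega) (by omega)).mul_right _
      rw [(CharP.cast_eq_zero_iff K p _).mpr hdvd, zero_smul]
    · rw [mono_eq_zero _ h', smul_zero]

theorem partialLin_leibniz_mono (a : Θ) (i j : Θ →₀ ℕ) (hi : ∀ b, i b < p ^ s b)
    (hj : ∀ b, j b < p ^ s b) :
    partialLin a (mono i * mono j : DPAlg K p s)
      = mono i * partialLin a (mono j) + mono j * partialLin a (mono i) := by
  rw [mono_mul_mono i j hi hj, map_smul]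
  by_cases hia : i a = 0
  · rw [partialLin_eq_zero a i hia, mul_zero, add_zero]
    by_cases hja : j a = 0
    · rw [partialLin_eq_zero a j hja, mul_zero, partialLin_eq_zero, smul_zero]
      rw [Finsupp.add_apply, hia, hja]
    · rw [partialLin_mul_mono a i j hi hj (by rw [Finsupp.add_apply]; omega),
        partialLin_of_ne a j hj hja, mono_mul_mono i _ hi (lt_of_sub_single a j hj),
        add_sub_single a i j hja, binom_split a i j, binom_split a i (j - Finsupp.single a 1),
        erase_sub_single, hia, Nat.choose_zero_right, Nat.choose_zero_right]
  · by_cases hja : j a = 0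
    · rw [partialLin_eq_zero a j hja, mul_zero, zero_add,
        partialLin_mul_mono a i j hi hj (by rw [Finsupp.add_apply]; omega),
        partialLin_of_ne a i hi hia, mono_mul_mono j _ hj (lt_of_sub_single a i hi),
        add_sub_single a j i hia, binom_comm i j, add_comm i j, binom_split a j i,
        binom_split a j (i - Finsupp.single a 1),
        erase_sub_single, hja, Nat.choose_zero_right, Nat.choose_zero_right]
    · rw [partialLin_mul_mono a i j hi hj (by rw [Finsupp.add_apply]; omega),
        partialLin_of_ne a j hj hja, partialLin_of_ne a i hi hia,
        mono_mul_mono i _ hi (lt_of_sub_single a j hj),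
        mono_mul_mono j _ hj (lt_of_sub_single a i hi),
        add_sub_single a i j hja, add_sub_single a j i hia, add_comm j i, ← add_smul,
        ← Nat.cast_add, binom_comm j, binom_split a i j,
        binom_split a i (j - Finsupp.single a 1), binom_split a (i - Finsupp.single a 1) j,
        erase_sub_single, erase_sub_single, ← add_mul, sub_single_same, sub_single_same]
      congr 3
      obtain ⟨m, hm⟩ := Nat.exists_eq_succ_of_ne_zero hia
      obtain ⟨n, hn⟩ := Nat.exists_eq_succ_of_ne_zero hja
      rw [hm, hn]
      have := Nat.choose_succ_succ (m + n + 1) m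
      have e1 : m.succ + n.succ = (m + n + 1) + 1 := by omega
      have e2 : m.succ + (n.succ - 1) = m + n + 1 := by omega
      have e3 : m.succ - 1 + n.succ = m + n + 1 := by omega
      rw [e1, e2, e3, Nat.succ_sub_one]
      simp only [Nat.succ_eq_add_one] at this ⊢
      omega

/-- The partial derivation `∂_a` of the divided power algebra. -/
noncomputable def partialD (a : Θ) : Derivation K (DPAlg K p s) (DPAlg K p s) :=
  Derivation.mk' (partialLin a) (leibniz_of_mono _ (partialLin_leibniz_mono a))

/-- The possibly infinite sum `∑_a f_a ∂_a` as a linear map; it is finite on each monomial. -/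
noncomputable def specialLin (f : Θ → DPAlg K p s) : DPAlg K p s →ₗ[K] DPAlg K p s :=
  lin fun i => ∑ a ∈ i.support, f a * partialD a (mono i)

theorem specialLin_mono (f : Θ → DPAlg K p s) (i : Θ →₀ ℕ) (t : Finset Θ)
    (ht : i.support ⊆ t) :
    specialLin f (mono i) = ∑ a ∈ t, f a * partialD a (mono i) := by
  by_cases hi : ∀ b, i b < p ^ s b
  · rw [specialLin, lin_mono _ i hi]
    refine Finset.sum_subset ht fun a _ ha => ?_
    have : partialD a (mono i : DPAlg K p s) = 0 :=
      partialLin_eq_zero a i (Finsupp.notMem_support_iff.mp ha)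
    rw [this, mul_zero]
  · rw [mono_eq_zero i hi, map_zero]
    exact (Finset.sum_eq_zero fun a _ => by rw [map_zero, mul_zero]).symm

theorem specialLin_leibniz_mono (f : Θ → DPAlg K p s) (i j : Θ →₀ ℕ) (hi : ∀ b, i b < p ^ s b)
    (hj : ∀ b, j b < p ^ s b) :
    specialLin f (mono i * mono j)
      = mono i * specialLin f (mono j) + mono j * specialLin f (mono i) := by
  classical
  rw [specialLin_mono f i (i.support ∪ j.support) Finset.subset_union_left,
    specialLin_mono f j (i.support ∪ j.support) Finset.subset_union_right,
    mono_mul_mono i j hi hj, map_smul,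
    specialLin_mono f (i + j) (i.support ∪ j.support) Finsupp.support_add,
    Finset.smul_sum, Finset.mul_sum, Finset.mul_sum, ← Finset.sum_add_distrib]
  refine Finset.sum_congr rfl fun a _ => ?_
  rw [← mul_smul_comm, ← Derivation.map_smul, ← mono_mul_mono i j hi hj, Derivation.leibniz,
    smul_eq_mul, smul_eq_mul]
  ring

/-- The derivation `∑_a f_a ∂_a` with arbitrary (infinitely many) coefficients `f_a`. -/
noncomputable def specialD (f : Θ → DPAlg K p s) : Derivation K (DPAlg K p s) (DPAlg K p s) :=
  Derivation.mk' (specialLin f) (leibniz_of_mono _ (specialLin_leibniz_mono f))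

end Derivations

end DPAlg

/-! ## Restricted subalgebras of `Der A` and their growth -/

section Restricted

variable {K : Type*} [Field K] {p : ℕ} [Fact p.Prime] [CharP K p] {A : Type*} [CommRing A]
  [Algebra K A]

theorem derivation_pow_leibniz (D : Derivation K A A) (a b : A) :
    ((D : A →ₗ[K] A) ^ p) (a * b)
      = a • ((D : A →ₗ[K] A) ^ p) b + b • ((D : A →ₗ[K] A) ^ p) a := by
  set d : Module.End K A := (D : A →ₗ[K] A) with hd
  set X : Module.End K (TensorProduct K A A) := LinearMap.lTensor A d with hX
  set Y : Module.End K (TensorProduct K A A) := LinearMap.rTensor A d with hY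
  have hXn : ∀ n : ℕ, X ^ n = LinearMap.lTensor A (d ^ n) := fun n => LinearMap.lTensor_pow d n
  have hYn : ∀ n : ℕ, Y ^ n = LinearMap.rTensor A (d ^ n) := fun n => LinearMap.rTensor_pow d n
  have hcomm : Commute X Y := by
    refine TensorProduct.ext' fun u v => ?_
    simp [hX, hY]
  have hmul : ∀ n : ℕ, (d ^ n : Module.End K A) ∘ₗ LinearMap.mul' K A
      = LinearMap.mul' K A ∘ₗ ((X + Y) ^ n : Module.End K _) := by
    intro n
    induction n with
    | zero => rfl
    | succ n ih =>
      have h1 : d ∘ₗ LinearMap.mul' K A = LinearMap.mul' K A ∘ₗ (X + Y) := by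
        refine TensorProduct.ext' fun u v => ?_
        simp [hX, hY, hd, mul_comm]
      rw [pow_succ, pow_succ, Module.End.mul_eq_comp, Module.End.mul_eq_comp,
        LinearMap.comp_assoc, h1, ← LinearMap.comp_assoc, ih, LinearMap.comp_assoc]
  have : CharP (Module.End K (TensorProduct K A A)) p ∨
      Subsingleton (Module.End K (TensorProduct K A A)) := by
    rcases subsingleton_or_nontrivial (Module.End K (TensorProduct K A A)) with h | h
    · exact Or.inr h
    · exact Or.inl (charP_of_injective_algebraMap
        (algebraMap K (Module.End K (TensorProduct K A A))).injective p)
  have hpow : (X + Y) ^ p = X ^ p + Y ^ p := by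
    rcases this with h | h
    · exact add_pow_char_of_commute p hcomm
    · exact Subsingleton.elim _ _
  have := LinearMap.congr_fun (hmul p) (a ⊗ₜ[K] b)
  rw [hpow, hXn, hYn] at this
  simpa [mul_comm] using this

variable (p) in
/-- The `p`-mapping of `Der A`: the `p`-th power of a derivation, taken in `End A`. -/
def Derivation.pMap (D : Derivation K A A) : Derivation K A A :=
  Derivation.mk' ((D : A →ₗ[K] A) ^ p) (derivation_pow_leibniz D)

variable (K p) in
/-- `Lie_p(X)`: the restricted subalgebra of `Der A` generated by `X`, that is, the smallest Lie
subalgebra that contains `X` and is closed under the `p`-mapping. -/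
def lieP (X : Set (Derivation K A A)) : LieSubalgebra K (Derivation K A A) :=
  sInf {L | X ⊆ L ∧ ∀ D ∈ L, Derivation.pMap p D ∈ L}

theorem mem_lieP (X : Set (Derivation K A A)) (D : Derivation K A A) :
    D ∈ lieP K p X ↔ ∀ L : LieSubalgebra K (Derivation K A A),
      X ⊆ L → (∀ E ∈ L, Derivation.pMap p E ∈ L) → D ∈ L := by
  unfold lieP
  rw [← SetLike.mem_coe, LieSubalgebra.coe_sInf]
  simp only [Set.mem_iInter, Set.mem_ofPred_eq, and_imp, SetLike.mem_coe]

/-- The right-normed commutator `[x_1, [x_2, [..., x_s]]]` of a (non-empty) list. -/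
def rightNormed {L : Type*} [LieRing L] : List L → L
  | [] => 0
  | [x] => x
  | x :: y :: l => ⁅x, rightNormed (y :: l)⁆

variable (K p) in
/-- The span of all `[x_1, ..., x_s]^(p^k)` with `x_i ∈ X`, `s ≥ 1`, `k ≥ 0` and `s * p ^ k ≤ n`. -/
def growthSpace (X : Set (Derivation K A A)) (n : ℕ) : Submodule K (Derivation K A A) :=
  Submodule.span K {D | ∃ (l : List (Derivation K A A)) (k : ℕ), l ≠ [] ∧ (∀ x ∈ l, x ∈ X) ∧
    l.length * p ^ k ≤ n ∧ D = (Derivation.pMap p)^[k] (rightNormed l)}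

variable (K p) in
/-- The growth function of `Lie_p(X)` with respect to the generating set `X`. -/
noncomputable def growth (X : Set (Derivation K A A)) (n : ℕ) : ℕ :=
  Module.finrank K (growthSpace K p X n)

variable (K p) in
/-- The (upper) Gelfand-Kirillov dimension of `Lie_p(X)`, computed from the generating set `X`. -/
noncomputable def GKdim (X : Set (Derivation K A A)) : EReal :=
  Filter.limsup (fun n : ℕ => ((Real.log (growth K p X n) / Real.log n : ℝ) : EReal)) Filter.atTop

end Restricted

/-! ## Clover restricted Lie algebras -/

namespace Clover

/-- The three families of variables. -/
inductive Letter where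
  | x : Letter
  | y : Letter
  | z : Letter

/-- The truncation exponents: `S n` for `x_n`, and `R n` for both `y_n` and `z_n`. -/
def bound (S R : ℕ → ℕ) : Letter × ℕ → ℕ
  | (.x, n) => S n
  | (.y, n) => R n
  | (.z, n) => R n

variable (K : Type*) [Field K] (p : ℕ) [Fact p.Prime] [CharP K p] (S R : ℕ → ℕ)

/-- The algebra `R(Ξ)` for the tuple `Ξ = (S_n, R_n | n ≥ 0)`. -/
abbrev Alg : Type _ := DPAlg K p (bound S R)

/-- The top divided power `a_n^(p^e - 1)` of the variable `a_n`, where `e` is its truncation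
exponent. -/
noncomputable def top (a : Letter) (n : ℕ) : Alg K p S R :=
  DPAlg.mono (Finsupp.single (a, n) (p ^ bound S R (a, n) - 1))

/-- The pivot element `v_i = ∑_{j ≥ i} (∏_{i ≤ k < j} x_k^(p^S_k - 1) y_k^(p^R_k - 1)) ∂_{x_j}`. -/
noncomputable def v (i : ℕ) : Derivation K (Alg K p S R) (Alg K p S R) :=
  DPAlg.specialD fun
    | (.x, j) => if i ≤ j then ∏ k ∈ Finset.Ico i j, (top K p S R .x k * top K p S R .y k) else 0
    | _ => 0

/-- The pivot element `w_i = ∑_{j ≥ i} (∏_{i ≤ k < j} y_k^(p^R_k - 1) x_k^(p^S_k - 1)) ∂_{y_j}`. -/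
noncomputable def w (i : ℕ) : Derivation K (Alg K p S R) (Alg K p S R) :=
  DPAlg.specialD fun
    | (.y, j) => if i ≤ j then ∏ k ∈ Finset.Ico i j, (top K p S R .y k * top K p S R .x k) else 0
    | _ => 0

/-- The pivot element `u_i = ∑_{j ≥ i} (∏_{i ≤ k < j} z_k^(p^R_k - 1) x_k^(p^S_k - 1)) ∂_{z_j}`. -/
noncomputable def u (i : ℕ) : Derivation K (Alg K p S R) (Alg K p S R) :=
  DPAlg.specialD fun
    | (.z, j) => if i ≤ j then ∏ k ∈ Finset.Ico i j, (top K p S R .z k * top K p S R .x k) else 0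
    | _ => 0

/-- The clover restricted Lie algebra `T(Ξ) = Lie_p(v_0, w_0, u_0)` inside `Der R(Ξ)`. -/
noncomputable def T : LieSubalgebra K (Derivation K (Alg K p S R) (Alg K p S R)) :=
  lieP K p {v K p S R 0, w K p S R 0, u K p S R 0}

end Clover

/-! ### Jacobson's formula for p-th powers in characteristic p -/

section CharPIdentities

/-! Write P_n = ∏_{k<n} (p^{S_k} + p^{R_k} − 1). Let partial derivatives and pivot elements of level
n have weight P_n, and let the variables of level n have weight −P_n. The recursion for the pivots
is then homogeneous.

Upper bound. Let `filt m` be the span of the powers ∂^{p^k} and of the tails t·(pivot of level n+1),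
all of weight at most m. Here t is a monomial in variables of level at most n whose level-n part
involves only the two letters of the recursion; that part is not of top degree unless t is exactly
the monomial of the recursion. These spaces satisfy [filt m, filt m'] ⊆ filt (m+m') (`lie_mem_filt`)
and (filt m)^p ⊆ filt (mp) (`pMap_mem_filt`), so a finite generating set inside `filt C` has its
n-th growth space inside `filt (Cn)`. To count tails, record the missing exponents of t. The weight
inequality `tail_inequality` bounds, for each of the three letters, a number written in the mixed
radix system with place values P_j, and it bounds n by a logarithm. Three numbers of size O(m) and
one of size O(log m) determine the tail, whence dim filt m = O(m^3 log m), and the logarithm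
disappears in the exponent.

Lower bound. Let V_n be the span of the commutators of length at most n in X. If V_k = V_{k+1}, then
V_k is a finite-dimensional space containing X and normalized by X, hence also by Lie_p(X). All v_i
lie in Lie_p(X) (`pivot_mem_T`) and act on V_k, so some nontrivial combination of them kills V_k and
is central. This contradicts `eq_zero_of_lie_eq_zero`, where brackets with the w_m detect any such
combination. So the chain V_n is strict and the growth is at least n. -/

theorem cast_choose_pred_prime {B : Type*} [Ring B] {p : ℕ} (hp : p.Prime) (h0 : (p : B) = 0)
    (i : ℕ) (hi : i ≤ p - 1) : ((p - 1).choose i : B) = (-1) ^ i := by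
  induction i with
  | zero => simp
  | succ i ih =>
    have h1 : p.choose (i + 1) = (p - 1).choose i + (p - 1).choose (i + 1) := by
      obtain ⟨q, rfl⟩ := Nat.exists_eq_succ_of_ne_zero hp.ne_zero
      exact Nat.choose_succ_succ q i
    have h2 : ((p.choose (i + 1) : ℕ) : B) = 0 := by
      obtain ⟨c, hc⟩ := hp.dvd_choose_self (k := i + 1) (by omega) (by omega)
      rw [hc, Nat.cast_mul, h0, zero_mul]
    rw [h1, Nat.cast_add, ih (by omega)] at h2
    rw [pow_succ, mul_neg_one]
    exact (neg_eq_of_add_eq_zero_right h2).symm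

/-- Binomial theorem: modulo p the coefficient is (−1)^(p−1−i), which cancels the sign of
(−y)^(p−1−i). -/
theorem Commute.sub_pow_pred_prime {B : Type*} [Ring B] {p : ℕ} (hp : p.Prime)
    (h0 : (p : B) = 0) {x y : B} (h : Commute x y) :
    (x - y) ^ (p - 1) = ∑ i ∈ Finset.range p, x ^ i * y ^ (p - 1 - i) := by
  rw [sub_eq_add_neg, h.neg_right.add_pow, Nat.sub_add_cancel hp.one_le]
  refine Finset.sum_congr rfl fun i hi => ?_
  have hi' : i ≤ p - 1 := by have := Finset.mem_range.mp hi; omega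
  have h1 := cast_choose_pred_prime hp h0 (p - 1 - i) (by omega)
  rw [Nat.choose_symm hi'] at h1
  rw [h1, neg_pow, mul_assoc]
  congr 1
  rw [((Commute.neg_one_left y).pow_pow _ _).eq, mul_assoc, ← pow_add, ← two_mul,
    pow_mul, neg_one_sq, one_pow, mul_one]

open Polynomial in
theorem derivative_linear_pow {A : Type*} [Ring A] (a b : A) (n : ℕ) :
    derivative ((C a * X + C b) ^ n)
      = ∑ i ∈ Finset.range n, (C a * X + C b) ^ i * C a * (C a * X + C b) ^ (n - 1 - i) := by
  set c : A[X] := C a * X + C b with hc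
  have hd : derivative c = C a := by simp [hc]
  induction n with
  | zero => simp
  | succ n ih =>
    rw [pow_succ, derivative_mul, ih, hd, Finset.sum_range_succ, Finset.sum_mul]
    congr 1
    · refine Finset.sum_congr rfl fun i hi => ?_
      have := Finset.mem_range.mp hi
      rw [mul_assoc, ← pow_succ]
      congr 2
      omega
    · simp

open Polynomial in
/-- Jacobson's formula, up to the precise shape of the commutators: `(a + b)^p - a^p - b^p` is a
combination of `p`-fold commutators in `a` and `b`. -/
theorem add_pow_prime_sub_mem {K A : Type*} [Field K] [Ring A] [Algebra K A] {p : ℕ}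
    (hp : p.Prime) [CharP K p] (M : ℕ → Submodule K A) {a b : A} (ha : a ∈ M 0)
    (hMa : ∀ k, ∀ x ∈ M k, a * x - x * a ∈ M (k + 1))
    (hMb : ∀ k, ∀ x ∈ M k, b * x - x * b ∈ M (k + 1)) :
    (a + b) ^ p - a ^ p - b ^ p ∈ M (p - 1) := by
  set c : A[X] := C a * X + C b with hc
  have h0K : (p : K) = 0 := CharP.cast_eq_zero K p
  set Lc : Module.End K A[X] := LinearMap.mulLeft K c with hLc
  set Rc : Module.End K A[X] := LinearMap.mulRight K c with hRc
  have h0 : ((p : ℕ) : Module.End K A[X]) = 0 := by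
    rw [← map_natCast (algebraMap K (Module.End K A[X])), h0K, map_zero]
  have hcomm : Commute Lc Rc := LinearMap.commute_mulLeft_right c c
  -- With c = aX + b, the noncommutative product rule gives ∑ cⁱ a c^(p−1−i). This is (L_c −
  -- R_c)^(p−1) applied to a, that is, a (p−1)-fold commutator with c.
  have hder : derivative (c ^ p) = ((Lc - Rc) ^ (p - 1)) (C a) := by
    rw [hcomm.sub_pow_pred_prime hp h0, derivative_linear_pow, LinearMap.sum_apply]
    refine Finset.sum_congr rfl fun i _ => ?_
    rw [hLc, hRc, LinearMap.pow_mulLeft, LinearMap.pow_mulRight]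
    simp [mul_assoc, hc]
  have hcoeff : ∀ k n : ℕ, (((Lc - Rc) ^ k) (C a)).coeff n ∈ M k := by
    intro k
    induction k with
    | zero =>
      intro n
      rw [pow_zero, Module.End.one_apply, coeff_C]
      split_ifs
      · exact ha
      · exact zero_mem _
    | succ k ih =>
      intro n
      rw [pow_succ', Module.End.mul_apply]
      set f := ((Lc - Rc) ^ k) (C a) with hf
      have e : (Lc - Rc) f = (C a * f - f * C a) * X + (C b * f - f * C b) := by
        simp only [hLc, hRc, hc, LinearMap.sub_apply, LinearMap.mulLeft_apply,
          LinearMap.mulRight_apply]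
        have : X * f = f * X := X_mul
        rw [add_mul, mul_add, mul_assoc (C a), this, sub_mul, mul_assoc f (C a), mul_assoc (C a)]
        abel
      rw [e, coeff_add, coeff_sub, coeff_C_mul, coeff_mul_C]
      refine add_mem ?_ (hMb k _ (ih n))
      cases n with
      | zero => rw [mul_coeff_zero, coeff_X_zero, mul_zero]; exact zero_mem _
      | succ n =>
        rw [coeff_mul_X, coeff_sub, coeff_C_mul, coeff_mul_C]
        exact hMa k _ (ih n)
  -- The derivative multiplies the coefficient of X^(i+1) by i+1, which is invertible modulo p below
  -- degree p.
  have hmid : ∀ i, i + 1 < p → (c ^ p).coeff (i + 1) ∈ M (p - 1) := by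
    intro i hi
    have h1 := hcoeff (p - 1) i
    rw [← hder, coeff_derivative] at h1
    have h2 : ((i + 1 : ℕ) : K) ≠ 0 := by
      intro h
      have := (CharP.cast_eq_zero_iff K p _).mp h
      exact absurd (Nat.le_of_dvd (Nat.succ_pos _) this) (by omega)
    have h3 : (c ^ p).coeff (i + 1)
        = ((i + 1 : ℕ) : K)⁻¹ • ((c ^ p).coeff (i + 1) * ((i : A) + 1)) := by
      have : ((i : A) + 1) = algebraMap K A ((i + 1 : ℕ) : K) := by simp
      rw [this, ← Algebra.commutes, ← Algebra.smul_def, smul_smul, inv_mul_cancel₀ h2, one_smul]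
    rw [h3]
    exact Submodule.smul_mem _ _ h1
  have hdeg : c.natDegree ≤ 1 := natDegree_linear_le
  have hdegp : (c ^ p).natDegree < p + 1 := by
    have := natDegree_pow_le_of_le p hdeg
    omega
  have hp1 : (c ^ p).coeff p = a ^ p := by
    have := coeff_pow_of_natDegree_le (m := p) hdeg
    rw [mul_one] at this
    rw [this]
    simp [hc]
  have hp0 : (c ^ p).coeff 0 = b ^ p := by
    have : ∀ n, (c ^ n).coeff 0 = b ^ n := by
      intro n
      induction n with
      | zero => simp
      | succ n ih => rw [pow_succ, mul_coeff_zero, ih, pow_succ]; simp [hc]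
    exact this p
  -- Evaluation at 1 is multiplicative even over a noncommutative ring, because 1 is central.
  have hev : (a + b) ^ p = ∑ i ∈ Finset.range (p + 1), (c ^ p).coeff i := by
    have h1 : eval 1 (c ^ p) = (a + b) ^ p := by
      have := map_pow (eval₂RingHom' (RingHom.id A) 1 fun x => Commute.one_right x) c p
      simpa [eval₂RingHom', hc, eval₂_id] using this
    rw [← h1, eval_eq_sum_range' hdegp]
    simp
  rw [hev, Finset.sum_range_succ, hp1]
  obtain ⟨q, rfl⟩ := Nat.exists_eq_succ_of_ne_zero hp.ne_zero
  rw [Finset.sum_range_succ', hp0]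
  have : ∀ s x y : A, s + x + y - y - x = s := fun s x y => by abel
  rw [this]
  refine sum_mem fun i hi => hmid i ?_
  have := Finset.mem_range.mp hi
  omega

end CharPIdentities

/-! ### Brackets and p-th powers of derivations -/

section DerivationLemmas

variable {K : Type*} [Field K] {A : Type*} [CommRing A] [Algebra K A]

theorem Derivation.lie_smul_derivation (D E : Derivation K A A) (f : A) :
    ⁅D, f • E⁆ = D f • E + f • ⁅D, E⁆ := by
  ext g
  simp only [Derivation.commutator_apply, Derivation.smul_apply, Derivation.add_apply,
    Derivation.leibniz, smul_eq_mul]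
  ring

theorem Derivation.smul_derivation_lie (D E : Derivation K A A) (f : A) :
    ⁅f • D, E⁆ = f • ⁅D, E⁆ - E f • D := by
  rw [← lie_skew, Derivation.lie_smul_derivation, ← lie_skew D E, neg_add, smul_neg]
  abel

theorem Derivation.map_prod_eq_zero {ι : Type*} (D : Derivation K A A) (s : Finset ι) (f : ι → A)
    (h : ∀ i ∈ s, D (f i) = 0) : D (∏ i ∈ s, f i) = 0 := by
  refine Finset.prod_induction f (fun a => D a = 0) (fun a b ha hb => ?_)
    (Derivation.map_one_eq_zero D) h
  rw [Derivation.leibniz, ha, hb, smul_zero, smul_zero, add_zero]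

/-- Since f is a constant for D, it moves out of every iteration. -/
theorem Derivation.smul_pow_apply (D : Derivation K A A) (f : A) (h : D f = 0) (n : ℕ) (g : A) :
    (((f • D : Derivation K A A) : A →ₗ[K] A) ^ n) g = f ^ n * (((D : A →ₗ[K] A) ^ n) g) := by
  have hn : ∀ n : ℕ, D (f ^ n) = 0 := fun n => by simp [Derivation.leibniz_pow, h]
  induction n with
  | zero => simp
  | succ n ih =>
    rw [pow_succ', Module.End.mul_apply, ih, pow_succ' (D : A →ₗ[K] A), Module.End.mul_apply]
    simp only [Derivation.coeFn_coe, Derivation.smul_apply, Derivation.leibniz, smul_eq_mul, hn]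
    ring

variable {p : ℕ} [hp : Fact p.Prime] [CharP K p]

theorem Derivation.pMap_apply (D : Derivation K A A) (f : A) :
    Derivation.pMap p D f = ((D : A →ₗ[K] A) ^ p) f := rfl

theorem Derivation.coe_pMap (D : Derivation K A A) :
    (Derivation.pMap p D : A →ₗ[K] A) = (D : A →ₗ[K] A) ^ p := rfl

theorem Derivation.coe_pMap_iterate (D : Derivation K A A) (k : ℕ) :
    (((Derivation.pMap p)^[k] D : Derivation K A A) : A →ₗ[K] A) = (D : A →ₗ[K] A) ^ p ^ k := by
  induction k with
  | zero => simp
  | succ k ih => rw [Function.iterate_succ_apply', Derivation.coe_pMap, ih, ← pow_mul, pow_succ]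

theorem Derivation.lie_pMap_eq_zero (D E : Derivation K A A) (h : ⁅D, E⁆ = 0) :
    ⁅Derivation.pMap p D, E⁆ = 0 := by
  have hc : Commute (D : Module.End K A) (E : Module.End K A) := by
    refine LinearMap.ext fun a => ?_
    have := congrArg (fun F : Derivation K A A => F a) h
    simp only [Derivation.commutator_apply, Derivation.zero_apply, sub_eq_zero] at this
    exact this
  have hc' := hc.pow_left p
  ext a
  rw [Derivation.commutator_apply, Derivation.zero_apply, sub_eq_zero]
  exact LinearMap.congr_fun hc' a

theorem Derivation.lie_pMap_iterate_eq_zero (D E : Derivation K A A) (h : ⁅D, E⁆ = 0) (k : ℕ) :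
    ⁅(Derivation.pMap p)^[k] D, E⁆ = 0 := by
  induction k with
  | zero => exact h
  | succ k ih => rw [Function.iterate_succ_apply']; exact Derivation.lie_pMap_eq_zero _ _ ih

theorem Derivation.pMap_smul_eq_zero (D : Derivation K A A) (f : A) (h : D f = 0)
    (hf : f ^ p = 0) : Derivation.pMap p (f • D) = 0 := by
  ext g
  rw [Derivation.pMap_apply, Derivation.smul_pow_apply D f h, hf, zero_mul, Derivation.zero_apply]

theorem Derivation.pMap_const_smul (D : Derivation K A A) (c : K) :
    Derivation.pMap p (c • D) = c ^ p • Derivation.pMap p D := by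
  ext g
  rw [Derivation.pMap_apply, Derivation.coe_smul_linearMap, smul_pow]
  rfl

/-- `(D + E)^p - D^p - E^p` lies in the `(p-1)`-st member of any sequence of subspaces that
contains `D`, `E` in its beginning and is shifted by the brackets with `D` and `E`. -/
theorem Derivation.pMap_add_sub_mem (M : ℕ → Submodule K (Derivation K A A))
    {D E : Derivation K A A} (hD : D ∈ M 0)
    (hMD : ∀ k, ∀ x ∈ M k, ⁅D, x⁆ ∈ M (k + 1)) (hME : ∀ k, ∀ x ∈ M k, ⁅E, x⁆ ∈ M (k + 1)) :
    Derivation.pMap p (D + E) - Derivation.pMap p D - Derivation.pMap p E ∈ M (p - 1) := by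
  -- Jacobson's formula needs an associative algebra, so the subspaces are transported to End A and
  -- pulled back by injectivity.
  let ι : Derivation K A A →ₗ[K] Module.End K A :=
    { toFun := fun D => (D : A →ₗ[K] A), map_add' := fun _ _ => rfl, map_smul' := fun _ _ => rfl }
  have hι : Function.Injective ι := fun D E h => Derivation.ext fun a => LinearMap.congr_fun h a
  have key := add_pow_prime_sub_mem (K := K) hp.out (fun k => (M k).map ι) (a := ι D) (b := ι E)
    ⟨D, hD, rfl⟩
    (by rintro k _ ⟨x, hx, rfl⟩
        exact ⟨⁅D, x⁆, hMD k x hx, Derivation.commutator_coe_linear_map⟩)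
    (by rintro k _ ⟨x, hx, rfl⟩
        exact ⟨⁅E, x⁆, hME k x hx, Derivation.commutator_coe_linear_map⟩)
  obtain ⟨z, hz, hz'⟩ := key
  have : z = Derivation.pMap p (D + E) - Derivation.pMap p D - Derivation.pMap p E := hι hz'
  exact this ▸ hz

end DerivationLemmas

/-! ### Monomials and special derivations of a divided power algebra -/

namespace DPAlg

section More

variable {K : Type*} [Field K] {Θ : Type*} {p : ℕ} {s : Θ → ℕ}

theorem exists_mono_mul_mono (i j : Θ →₀ ℕ) :
    ∃ c : K, (mono i * mono j : DPAlg K p s) = c • mono (i + j) := by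
  by_cases hi : ∀ a, i a < p ^ s a
  · by_cases hj : ∀ a, j a < p ^ s a
    · exact ⟨_, mono_mul_mono i j hi hj⟩
    · refine ⟨0, ?_⟩
      rw [mono_eq_zero j hj, zero_smul, ← mulLin_apply, map_zero]
  · refine ⟨0, ?_⟩
    rw [mono_eq_zero i hi, zero_smul, ← mulLin_apply, LinearMap.map_zero₂]

variable [hp : Fact p.Prime]

theorem mono_mul_mono_of_disjoint (i j : Θ →₀ ℕ) (h : ∀ a, i a = 0 ∨ j a = 0) :
    (mono i * mono j : DPAlg K p s) = mono (i + j) := by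
  by_cases hi : ∀ a, i a < p ^ s a
  · by_cases hj : ∀ a, j a < p ^ s a
    · have hb : binom i j = 1 := by
        refine Finset.prod_eq_one fun a _ => ?_
        rcases h a with h | h <;> simp [h]
      rw [mono_mul_mono i j hi hj, hb, Nat.cast_one, one_smul]
    · rw [mono_eq_zero j hj, mul_zero, mono_eq_zero]
      exact fun h' => hj fun a => lt_of_le_of_lt (Nat.le_add_left _ _) (h' a)
  · rw [mono_eq_zero i hi, zero_mul, mono_eq_zero]
    exact fun h' => hi fun a => lt_of_le_of_lt (Nat.le_add_right _ _) (h' a)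

theorem mono_mul_mono_eq_zero (i j : Θ →₀ ℕ) (a : Θ) (h : p ^ s a ≤ i a + j a) :
    (mono i * mono j : DPAlg K p s) = 0 := by
  obtain ⟨c, hc⟩ := exists_mono_mul_mono (K := K) (p := p) (s := s) i j
  rw [hc, mono_eq_zero, smul_zero]
  exact fun h' => absurd (h' a) (by rw [Finsupp.add_apply]; omega)

theorem exists_mono_pow (i : Θ →₀ ℕ) (k : ℕ) :
    ∃ c : K, (mono i ^ k : DPAlg K p s) = c • mono (k • i) := by
  induction k with
  | zero => exact ⟨1, by rw [pow_zero, zero_smul, one_smul]; rfl⟩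
  | succ k ih =>
    obtain ⟨c, hc⟩ := ih
    obtain ⟨d, hd⟩ := exists_mono_mul_mono (K := K) (p := p) (s := s) (k • i) i
    exact ⟨c * d, by rw [pow_succ, hc, smul_mul_assoc, hd, smul_smul, succ_nsmul]⟩

/-- For an exponent e > 0 the last multiplication contributes (pe choose e) = p·(pe−1 choose e−1),
which vanishes in K. -/
theorem mono_pow_prime [CharP K p] (i : Θ →₀ ℕ) (hi : i ≠ 0) : (mono i ^ p : DPAlg K p s) = 0 := by
  obtain ⟨a, ha⟩ := Finsupp.ne_iff.mp hi
  rw [Finsupp.zero_apply] at ha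
  obtain ⟨q, hq⟩ := Nat.exists_eq_succ_of_ne_zero hp.out.ne_zero
  obtain ⟨c, hc⟩ := exists_mono_pow (K := K) (p := p) (s := s) i q
  rw [show (mono i ^ p : DPAlg K p s) = mono i ^ (q + 1) from congrArg (mono i ^ ·) hq, pow_succ,
    hc, smul_mul_assoc]
  by_cases hi : ∀ a, i a < p ^ s a
  · by_cases hj : ∀ a, (q • i) a < p ^ s a
    · rw [mono_mul_mono _ _ hj hi]
      have hdvd : p ∣ binom (q • i) i := by
        rw [binom_split a]
        refine Dvd.dvd.mul_right ?_ _
        have e : (q • i) a + i a = p * i a := by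
          rw [Finsupp.smul_apply, smul_eq_mul, hq, Nat.succ_mul]
        obtain ⟨b, hb⟩ := Nat.exists_eq_succ_of_ne_zero ha
        rw [Nat.choose_symm_add, e]
        have h1 : (p * i a).choose (i a) * i a = p * i a * (p * i a - 1).choose (i a - 1) := by
          have hpos : 0 < p * i a := Nat.mul_pos hp.out.pos (Nat.pos_of_ne_zero ha)
          obtain ⟨n, hn⟩ := Nat.exists_eq_succ_of_ne_zero hpos.ne'
          rw [hn, hb]
          exact (Nat.add_one_mul_choose_eq n b).symm
        have h2 : (p * i a).choose (i a) = p * (p * i a - 1).choose (i a - 1) := by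
          refine Nat.eq_of_mul_eq_mul_right (Nat.pos_of_ne_zero ha) ?_
          rw [h1]; ring
        exact ⟨_, h2⟩
      rw [(CharP.cast_eq_zero_iff K p _).mpr hdvd, zero_smul, smul_zero]
    · rw [mono_eq_zero _ hj, zero_mul, smul_zero]
  · rw [mono_eq_zero _ hi, mul_zero, smul_zero]

theorem derivation_ext_mono {D E : Derivation K (DPAlg K p s) (DPAlg K p s)}
    (h : ∀ i : Θ →₀ ℕ, (∀ a, i a < p ^ s a) → D (mono i) = E (mono i)) : D = E := by
  have : (D : DPAlg K p s →ₗ[K] DPAlg K p s) = E := lin_ext h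
  exact Derivation.ext fun a => LinearMap.congr_fun this a

variable [CharP K p]

theorem partialD_eq_zero (a : Θ) (i : Θ →₀ ℕ) (h : i a = 0) :
    partialD a (mono i : DPAlg K p s) = 0 := partialLin_eq_zero a i h

theorem partialD_of_ne (a : Θ) (i : Θ →₀ ℕ) (hi : ∀ b, i b < p ^ s b) (h : i a ≠ 0) :
    partialD a (mono i : DPAlg K p s) = mono (i - Finsupp.single a 1) := partialLin_of_ne a i hi h

theorem partialD_pow_mono (a : Θ) (i : Θ →₀ ℕ) (hi : ∀ b, i b < p ^ s b) (n : ℕ) :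
    (((partialD a : Derivation K (DPAlg K p s) (DPAlg K p s)) :
      DPAlg K p s →ₗ[K] DPAlg K p s) ^ n) (mono i)
      = if n ≤ i a then mono (i - Finsupp.single a n) else 0 := by
  induction n with
  | zero => simp
  | succ n ih =>
    rw [pow_succ', Module.End.mul_apply, ih, Derivation.coeFn_coe]
    have hsub : (i - Finsupp.single a n : Θ →₀ ℕ) a = i a - n := by simp
    by_cases h : n ≤ i a
    · rw [if_pos h]
      by_cases h' : n + 1 ≤ i a
      · rw [if_pos h', partialD_of_ne a _ (fun b => lt_of_le_of_lt (Nat.sub_le _ _) (hi b))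
          (by rw [hsub]; omega), tsub_tsub, ← Finsupp.single_add]
      · rw [if_neg h', partialD_eq_zero a _ (by rw [hsub]; omega)]
    · rw [if_neg h, if_neg (by omega), map_zero]

/-- The `p^k`-th power of `∂_a`. -/
noncomputable def partialPow (a : Θ) (k : ℕ) : Derivation K (DPAlg K p s) (DPAlg K p s) :=
  (Derivation.pMap p)^[k] (partialD a)

theorem partialPow_mono (a : Θ) (k : ℕ) (i : Θ →₀ ℕ) (hi : ∀ b, i b < p ^ s b) :
    partialPow a k (mono i : DPAlg K p s)
      = if p ^ k ≤ i a then mono (i - Finsupp.single a (p ^ k)) else 0 := by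
  rw [← partialD_pow_mono a i hi, ← Derivation.coe_pMap_iterate]
  rfl

theorem partialPow_mono_eq_zero (a : Θ) (k : ℕ) (i : Θ →₀ ℕ) (h : i a = 0) :
    partialPow a k (mono i : DPAlg K p s) = 0 := by
  by_cases hi : ∀ b, i b < p ^ s b
  · rw [partialPow_mono a k i hi, if_neg]
    rw [h, not_le]
    exact pow_pos hp.out.pos _
  · rw [mono_eq_zero i hi, map_zero]

theorem specialD_mono (f : Θ → DPAlg K p s) (i : Θ →₀ ℕ) (t : Finset Θ) (ht : i.support ⊆ t) :
    specialD f (mono i) = ∑ a ∈ t, f a * partialD a (mono i) := specialLin_mono f i t ht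

theorem specialD_add (f g : Θ → DPAlg K p s) : specialD (f + g) = specialD f + specialD g := by
  refine derivation_ext_mono fun i _ => ?_
  simp only [Derivation.add_apply, specialD_mono _ i _ subset_rfl, Pi.add_apply, add_mul,
    Finset.sum_add_distrib]

theorem specialD_smul (c : DPAlg K p s) (f : Θ → DPAlg K p s) :
    specialD (fun a => c * f a) = c • specialD f := by
  refine derivation_ext_mono fun i _ => ?_
  simp only [Derivation.smul_apply, specialD_mono _ i _ subset_rfl, smul_eq_mul, Finset.mul_sum,
    mul_assoc]

theorem specialD_single [DecidableEq Θ] (a : Θ) :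
    specialD (Pi.single a (1 : DPAlg K p s)) = partialD a := by
  refine derivation_ext_mono fun i _ => ?_
  rw [specialD_mono _ i (insert a i.support) (Finset.subset_insert _ _),
    Finset.sum_eq_single a]
  · rw [Pi.single_eq_same, one_mul]
  · intro b _ hb
    rw [Pi.single_eq_of_ne hb, zero_mul]
  · exact fun h => absurd (Finset.mem_insert_self _ _) h

theorem partialD_comm (a b : Θ) :
    ⁅(partialD a : Derivation K (DPAlg K p s) (DPAlg K p s)),
      (partialD b : Derivation K (DPAlg K p s) (DPAlg K p s))⁆ = 0 := by
  classical
  by_cases hab : a = b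
  · rw [hab, lie_self]
  refine derivation_ext_mono fun i hi => ?_
  have hsa : ∀ b, (i - Finsupp.single a 1 : Θ →₀ ℕ) b < p ^ s b := lt_of_sub_single a i hi
  have hsb : ∀ c, (i - Finsupp.single b 1 : Θ →₀ ℕ) c < p ^ s c := lt_of_sub_single b i hi
  have e1 : (i - Finsupp.single b 1 : Θ →₀ ℕ) a = i a := by
    rw [Finsupp.tsub_apply, Finsupp.single_eq_of_ne hab, Nat.sub_zero]
  have e2 : (i - Finsupp.single a 1 : Θ →₀ ℕ) b = i b := by
    rw [Finsupp.tsub_apply, Finsupp.single_eq_of_ne (Ne.symm hab), Nat.sub_zero]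
  rw [Derivation.commutator_apply, Derivation.zero_apply]
  by_cases ha : i a = 0
  · rw [partialD_eq_zero a i ha, map_zero]
    by_cases hb : i b = 0
    · rw [partialD_eq_zero b i hb, map_zero, sub_zero]
    · rw [partialD_of_ne b i hi hb, partialD_eq_zero a _ (e1.trans ha), sub_zero]
  · rw [partialD_of_ne a i hi ha]
    by_cases hb : i b = 0
    · rw [partialD_eq_zero b i hb, map_zero, partialD_eq_zero b _ (e2.trans hb), sub_zero]
    · rw [partialD_of_ne b i hi hb, partialD_of_ne a _ hsb (by rwa [e1]),
        partialD_of_ne b _ hsa (by rwa [e2]), tsub_right_comm, sub_self]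

/-- Partial derivatives commute, so the bracket only differentiates the coefficients. -/
theorem partialD_lie_specialD (b : Θ) (f : Θ → DPAlg K p s) :
    ⁅(partialD b : Derivation K (DPAlg K p s) (DPAlg K p s)),
      (specialD f : Derivation K (DPAlg K p s) (DPAlg K p s))⁆ = specialD (fun a => partialD b (f a)) := by
  refine derivation_ext_mono fun i hi => ?_
  have h1 : specialD f (partialD b (mono i)) = ∑ a ∈ i.support,
      f a * partialD a (partialD b (mono i)) := by
    by_cases hb : i b = 0
    · rw [partialD_eq_zero b i hb]
      simp
    · rw [partialD_of_ne b i hi hb]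
      exact specialD_mono f _ _ (Finsupp.support_mono tsub_le_self)
  rw [Derivation.commutator_apply, h1, specialD_mono _ i _ subset_rfl,
    specialD_mono _ i _ subset_rfl, map_sum, ← Finset.sum_sub_distrib]
  refine Finset.sum_congr rfl fun a _ => ?_
  have h2 := congrArg (fun D : Derivation K (DPAlg K p s) (DPAlg K p s) => D (mono i))
    (partialD_comm (K := K) (p := p) (s := s) b a)
  simp only [Derivation.commutator_apply, Derivation.zero_apply, sub_eq_zero] at h2
  rw [Derivation.leibniz, smul_eq_mul, smul_eq_mul, h2]
  ring

theorem specialD_mono_eq_zero (f : Θ → DPAlg K p s) (i : Θ →₀ ℕ) (h : ∀ a, i a ≠ 0 → f a = 0) :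
    specialD f (mono i) = 0 := by
  rw [specialD_mono _ i _ subset_rfl]
  exact Finset.sum_eq_zero fun a ha => by
    rw [h a (Finsupp.mem_support_iff.mp ha), zero_mul]

end More

end DPAlg

/-! ### Weights, pivot elements and tails -/

namespace Clover

open DPAlg

instance : DecidableEq Letter := fun a b => by
  cases a <;> cases b <;> first | exact isTrue rfl | exact isFalse (by simp)

instance : Fintype Letter := ⟨{.x, .y, .z}, fun a => by cases a <;> simp⟩

/-- The second letter occurring in the recursion of the pivot element of a letter. -/
def partner : Letter → Letter
  | .x => .y
  | .y => .x
  | .z => .x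

theorem partner_ne (c : Letter) : partner c ≠ c := by cases c <;> simp [partner]

theorem eq_x_or_partner_eq_x (c : Letter) : c = .x ∨ partner c = .x := by
  cases c <;> simp [partner]

/-- All exponents of variables of level at least `n` vanish. -/
def LevelLT (n : ℕ) (r : Letter × ℕ →₀ ℕ) : Prop := ∀ a : Letter × ℕ, n ≤ a.2 → r a = 0

theorem LevelLT.mono {m n : ℕ} {r : Letter × ℕ →₀ ℕ} (h : LevelLT m r) (hmn : m ≤ n) :
    LevelLT n r := fun a ha => h a (hmn.trans ha)

theorem LevelLT.add {n : ℕ} {r r' : Letter × ℕ →₀ ℕ} (h : LevelLT n r) (h' : LevelLT n r') :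
    LevelLT n (r + r') := fun a ha => by rw [Finsupp.add_apply, h a ha, h' a ha]

section Weights

variable (p : ℕ) (S R : ℕ → ℕ)

/-- The exponent of the monomial `a_n^(top) b_n^(top)`, where `b` is the partner of `a`. -/
noncomputable def topExp (c : Letter) (n : ℕ) : Letter × ℕ →₀ ℕ :=
  Finsupp.single (c, n) (p ^ bound S R (c, n) - 1)
    + Finsupp.single (partner c, n) (p ^ bound S R (partner c, n) - 1)

/-- The weight of the pivot elements of level `n`. -/
def pivotWeight (n : ℕ) : ℕ := ∏ k ∈ Finset.range n, (p ^ S k + p ^ R k - 1)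

/-- The weight of a monomial: the variables of level `n` have weight `pivotWeight n`. -/
noncomputable def weight (r : Letter × ℕ →₀ ℕ) : ℕ := r.sum fun a e => e * pivotWeight p S R a.2

variable {p S R}

theorem weight_add (r r' : Letter × ℕ →₀ ℕ) :
    weight p S R (r + r') = weight p S R r + weight p S R r' :=
  Finsupp.sum_add_index' (fun _ => zero_mul _) fun _ _ _ => add_mul _ _ _

theorem weight_single (a : Letter × ℕ) (e : ℕ) :
    weight p S R (Finsupp.single a e) = e * pivotWeight p S R a.2 :=
  Finsupp.sum_single_index (zero_mul _)

theorem weight_sub_single (r : Letter × ℕ →₀ ℕ) (a : Letter × ℕ) (e : ℕ) (h : e ≤ r a) :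
    weight p S R (r - Finsupp.single a e) + e * pivotWeight p S R a.2 = weight p S R r := by
  rw [← weight_single, ← weight_add, tsub_add_cancel_of_le (Finsupp.single_le_iff.mpr h)]

theorem pow_bound_add_partner (c : Letter) (n : ℕ) :
    p ^ bound S R (c, n) + p ^ bound S R (partner c, n) = p ^ S n + p ^ R n := by
  cases c <;> simp [partner, bound, add_comm]

theorem pivotWeight_succ (n : ℕ) :
    pivotWeight p S R (n + 1) = pivotWeight p S R n * (p ^ S n + p ^ R n - 1) :=
  Finset.prod_range_succ _ _

theorem topExp_apply (c : Letter) (n : ℕ) : topExp p S R c n (c, n) = p ^ bound S R (c, n) - 1 := by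
  have h : (c, n) ≠ (partner c, n) := fun h => partner_ne c (congrArg Prod.fst h).symm
  rw [topExp, Finsupp.add_apply, Finsupp.single_eq_same, Finsupp.single_eq_of_ne h, add_zero]

theorem topExp_apply_partner (c : Letter) (n : ℕ) :
    topExp p S R c n (partner c, n) = p ^ bound S R (partner c, n) - 1 := by
  have h : (partner c, n) ≠ (c, n) := fun h => partner_ne c (congrArg Prod.fst h)
  rw [topExp, Finsupp.add_apply, Finsupp.single_eq_same, Finsupp.single_eq_of_ne h, zero_add]

theorem topExp_apply_of_ne (c : Letter) (n : ℕ) (a : Letter × ℕ) (h1 : a ≠ (c, n))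
    (h2 : a ≠ (partner c, n)) : topExp p S R c n a = 0 := by
  rw [topExp, Finsupp.add_apply, Finsupp.single_eq_of_ne h1, Finsupp.single_eq_of_ne h2,
    add_zero]

theorem topExp_apply_of_level_ne (c : Letter) (n : ℕ) (a : Letter × ℕ) (h : a.2 ≠ n) :
    topExp p S R c n a = 0 :=
  topExp_apply_of_ne c n a (fun h' => h (congrArg Prod.snd h')) fun h' => h (congrArg Prod.snd h')

theorem levelLT_topExp (c : Letter) (n : ℕ) : LevelLT (n + 1) (topExp p S R c n) :=
  fun a ha => topExp_apply_of_level_ne c n a (by omega)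

theorem topExp_x (c : Letter) (n : ℕ) : topExp p S R c n (.x, n) = p ^ S n - 1 := by
  rcases eq_x_or_partner_eq_x c with rfl | h
  · exact topExp_apply _ _
  · rw [← h, topExp_apply_partner, h]; rfl

variable [hp : Fact p.Prime]

theorem topExp_lt (c : Letter) (n : ℕ) (a : Letter × ℕ) :
    topExp p S R c n a < p ^ bound S R a := by
  have hpos : 0 < p ^ bound S R a := pow_pos hp.out.pos _
  by_cases h1 : a = (c, n)
  · subst h1; rw [topExp_apply]; omega
  by_cases h2 : a = (partner c, n)
  · subst h2; rw [topExp_apply_partner]; omega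
  rwa [topExp_apply_of_ne c n a h1 h2]

/-- This is what makes the recursion of the pivots homogeneous, and it dictates the factor p^{S_n} +
p^{R_n} − 1 in `pivotWeight`. -/
theorem weight_topExp (c : Letter) (n : ℕ) :
    weight p S R (topExp p S R c n) + pivotWeight p S R n = pivotWeight p S R (n + 1) := by
  rw [topExp, weight_add, weight_single, weight_single, pivotWeight_succ, ← add_mul]
  have h := pow_bound_add_partner (p := p) (S := S) (R := R) c n
  have h1 : 0 < p ^ bound S R (c, n) := pow_pos hp.out.pos _
  have h2 : 0 < p ^ bound S R (partner c, n) := pow_pos hp.out.pos _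
  rw [← Nat.succ_mul, mul_comm]
  congr 1
  omega

theorem topExp_ne_zero (hS : ∀ n, 1 ≤ S n) (c : Letter) (n : ℕ) : topExp p S R c n ≠ 0 := by
  intro h
  have h1 := topExp_x (p := p) (S := S) (R := R) c n
  rw [h, Finsupp.zero_apply] at h1
  have h2 : p ≤ p ^ S n := Nat.le_self_pow (Nat.one_le_iff_ne_zero.mp (hS n)) p
  have := hp.out.two_le
  omega

end Weights

section Top

variable {K : Type*} [Field K] {p : ℕ} [hp : Fact p.Prime] {S R : ℕ → ℕ}

theorem top_mul_top_partner (c : Letter) (n : ℕ) :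
    top K p S R c n * top K p S R (partner c) n = mono (topExp p S R c n) := by
  classical
  unfold top topExp
  refine mono_mul_mono_of_disjoint _ _ fun a => ?_
  by_cases h : a = (c, n)
  · subst h
    exact Or.inr (Finsupp.single_eq_of_ne fun h => partner_ne c (congrArg Prod.fst h).symm)
  · exact Or.inl (Finsupp.single_eq_of_ne h)

/-- All three recursions use the top power of x_n, and twice that exponent is out of range. -/
theorem mono_topExp_mul_mono_topExp (hS : ∀ n, 1 ≤ S n) (c c' : Letter) (n : ℕ) :
    (mono (topExp p S R c n) * mono (topExp p S R c' n) : Alg K p S R) = 0 := by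
  refine mono_mul_mono_eq_zero _ _ (.x, n) ?_
  rw [topExp_x, topExp_x]
  have h2 : p ≤ p ^ S n := Nat.le_self_pow (Nat.one_le_iff_ne_zero.mp (hS n)) p
  have := hp.out.two_le
  change p ^ S n ≤ _
  omega

theorem mono_mul_topExp {n : ℕ} {r : Letter × ℕ →₀ ℕ} (hr : LevelLT n r) (c : Letter) :
    (mono r * mono (topExp p S R c n) : Alg K p S R) = mono (r + topExp p S R c n) := by
  refine mono_mul_mono_of_disjoint _ _ fun a => ?_
  by_cases h : a.2 = n
  · exact Or.inl (hr a h.ge)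
  · exact Or.inr (topExp_apply_of_level_ne c n a h)

end Top

section Pivots

variable (K : Type*) [Field K] (p : ℕ) [hp : Fact p.Prime] [CharP K p] (S R : ℕ → ℕ)

/-- The pivot element of level `i` of the letter `c`. -/
noncomputable def pivot (c : Letter) (i : ℕ) : Derivation K (Alg K p S R) (Alg K p S R) :=
  specialD fun a => if a.1 = c ∧ i ≤ a.2 then
    ∏ k ∈ Finset.Ico i a.2, (top K p S R c k * top K p S R (partner c) k) else 0

theorem v_eq_pivot (i : ℕ) : v K p S R i = pivot K p S R .x i := by
  unfold v pivot
  congr 1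
  funext ⟨l, j⟩
  cases l <;> simp [partner]

theorem w_eq_pivot (i : ℕ) : w K p S R i = pivot K p S R .y i := by
  unfold w pivot
  congr 1
  funext ⟨l, j⟩
  cases l <;> simp [partner]

theorem u_eq_pivot (i : ℕ) : u K p S R i = pivot K p S R .z i := by
  unfold u pivot
  congr 1
  funext ⟨l, j⟩
  cases l <;> simp [partner]

variable {K p S R}

theorem pivot_eq (c : Letter) (n : ℕ) :
    pivot K p S R c n = partialD (c, n) + (mono (topExp p S R c n) : Alg K p S R)
      • pivot K p S R c (n + 1) := by
  rw [← top_mul_top_partner, pivot, pivot, ← specialD_smul, ← specialD_single, ← specialD_add]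
  congr 1
  funext ⟨a, j⟩
  by_cases ha : a = c
  · subst ha
    rcases lt_trichotomy j n with h | h | h
    · have : (a, j) ≠ (a, n) := fun e => h.ne (congrArg Prod.snd e)
      rw [Pi.add_apply, Pi.single_eq_of_ne this, if_neg (by simp; omega),
        if_neg (by simp; omega)]
      simp
    · subst h
      rw [Pi.add_apply, Pi.single_eq_same, if_pos ⟨rfl, le_rfl⟩, if_neg (by simp)]
      simp
    · have : (a, j) ≠ (a, n) := fun e => h.ne' (congrArg Prod.snd e)
      rw [Pi.add_apply, Pi.single_eq_of_ne this, if_pos ⟨rfl, h.le⟩, if_pos ⟨rfl, h⟩, zero_add,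
        Finset.prod_eq_prod_Ico_succ_bot h]
  · have : (a, j) ≠ (c, n) := fun e => ha (congrArg Prod.fst e)
    rw [Pi.add_apply, Pi.single_eq_of_ne this, if_neg (fun h => ha h.1), if_neg (fun h => ha h.1)]
    simp

theorem pivot_mono_eq_zero (c : Letter) (n : ℕ) (r : Letter × ℕ →₀ ℕ) (hr : LevelLT n r) :
    pivot K p S R c n (mono r) = 0 :=
  specialD_mono_eq_zero _ _ fun a ha => if_neg fun h => ha (hr a h.2)

theorem partialD_lie_pivot (b : Letter × ℕ) (c : Letter) (n : ℕ) (h : b.2 < n) :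
    ⁅(partialD b : Derivation K (Alg K p S R) (Alg K p S R)), pivot K p S R c n⁆ = 0 := by
  rw [pivot, partialD_lie_specialD]
  refine derivation_ext_mono fun i _ => ?_
  rw [Derivation.zero_apply]
  refine specialD_mono_eq_zero _ _ fun a _ => ?_
  split_ifs
  · refine Derivation.map_prod_eq_zero _ _ _ fun k hk => ?_
    rw [top_mul_top_partner]
    have := (Finset.mem_Ico.mp hk).1
    exact partialD_eq_zero b _ (topExp_apply_of_level_ne c k b (by omega))
  · exact map_zero _

theorem partialPow_lie_pivot (b : Letter × ℕ) (k : ℕ) (c : Letter) (n : ℕ) (h : b.2 < n) :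
    ⁅(partialPow b k : Derivation K (Alg K p S R) (Alg K p S R)), pivot K p S R c n⁆ = 0 :=
  Derivation.lie_pMap_iterate_eq_zero _ _ (partialD_lie_pivot b c n h) k

theorem partialPow_lie_partialD (b b' : Letter × ℕ) (k : ℕ) :
    ⁅(partialPow b k : Derivation K (Alg K p S R) (Alg K p S R)),
      (partialD b' : Derivation K (Alg K p S R) (Alg K p S R))⁆ = 0 :=
  Derivation.lie_pMap_iterate_eq_zero _ _ (partialD_comm b b') k

theorem partialPow_lie_partialPow (b b' : Letter × ℕ) (k k' : ℕ) :
    ⁅(partialPow b k : Derivation K (Alg K p S R) (Alg K p S R)),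
      (partialPow b' k' : Derivation K (Alg K p S R) (Alg K p S R))⁆ = 0 := by
  have h := partialPow_lie_partialD (K := K) (p := p) (S := S) (R := R) b b' k
  rw [← lie_skew, neg_eq_zero] at h ⊢
  exact Derivation.lie_pMap_iterate_eq_zero _ _ h k'

/-- Expand both pivots once. The partials commute with each other and with the pivots of level n+1,
these pivots kill the level-n coefficients, and the product of the two coefficients vanishes. Only
the two terms in which a partial hits a coefficient survive. -/
theorem pivot_lie_pivot (hS : ∀ n, 1 ≤ S n) (c c' : Letter) (n : ℕ) :
    ⁅pivot K p S R c n, pivot K p S R c' n⁆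
      = (partialD (c, n) (mono (topExp p S R c' n) : Alg K p S R)) • pivot K p S R c' (n + 1)
        - (partialD (c', n) (mono (topExp p S R c n) : Alg K p S R)) • pivot K p S R c (n + 1) := by
  have h1 := partialD_lie_pivot (K := K) (p := p) (S := S) (R := R) (c, n) c' (n + 1)
    (Nat.lt_succ_self n)
  have h2 := partialD_lie_pivot (K := K) (p := p) (S := S) (R := R) (c', n) c (n + 1)
    (Nat.lt_succ_self n)
  have h3 := partialD_comm (K := K) (p := p) (s := bound S R) (c, n) (c', n)
  have h4 := pivot_mono_eq_zero (K := K) (p := p) (S := S) (R := R) c (n + 1)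
    (topExp p S R c' n) (levelLT_topExp c' n)
  have h5 := pivot_mono_eq_zero (K := K) (p := p) (S := S) (R := R) c' (n + 1)
    (topExp p S R c n) (levelLT_topExp c n)
  have h6 := mono_topExp_mul_mono_topExp (K := K) (p := p) (R := R) hS c' c n
  rw [pivot_eq c n, pivot_eq c' n, add_lie, lie_add, lie_add, Derivation.lie_smul_derivation, h1,
    h3, Derivation.lie_smul_derivation, Derivation.smul_derivation_lie,
    Derivation.smul_derivation_lie, Derivation.smul_apply, h4, ← lie_skew, h2, h5, smul_sub,
    smul_smul, h6]
  simp
  abel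

end Pivots

section Tails

variable (p : ℕ) (S R : ℕ → ℕ)

/-- The exponents of the monomials `t` for which `t • pivot c (n + 1)` is used to describe the
clover Lie algebras. -/
structure IsTail (c : Letter) (n : ℕ) (r : Letter × ℕ →₀ ℕ) : Prop where
  level : LevelLT (n + 1) r
  third : ∀ a, a ≠ c → a ≠ partner c → r (a, n) = 0
  deficient : r (c, n) + r (partner c, n) + 2 < p ^ S n + p ^ R n ∨ r = topExp p S R c n

variable {p S R}

theorem isTail_topExp (c : Letter) (n : ℕ) : IsTail p S R c n (topExp p S R c n) where
  level := levelLT_topExp c n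
  third _ h1 h2 := topExp_apply_of_ne c n _ (fun h => h1 (congrArg Prod.fst h))
    fun h => h2 (congrArg Prod.fst h)
  deficient := Or.inr rfl

variable [hp : Fact p.Prime]

theorem IsTail.le {c : Letter} {n : ℕ} {r : Letter × ℕ →₀ ℕ} (hr : IsTail p S R c n r) :
    r (c, n) + r (partner c, n) + 2 ≤ p ^ S n + p ^ R n := by
  rcases hr.deficient with h | h
  · exact h.le
  · have h' := pow_bound_add_partner (p := p) (S := S) (R := R) c n
    have h1 : 0 < p ^ bound S R (c, n) := pow_pos hp.out.pos _
    have h2 : 0 < p ^ bound S R (partner c, n) := pow_pos hp.out.pos _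
    rw [h, topExp_apply, topExp_apply_partner]
    omega

/-- Lowering any exponent of a tail leaves its level-n degree strictly below the maximum: the
exceptional tail `topExp` contains only level-n variables, so lowering it lowers that degree.
Factors of lower level are then free to be added. -/
theorem IsTail.add_sub_single {c : Letter} {n : ℕ} {r l : Letter × ℕ →₀ ℕ}
    (hr : IsTail p S R c n r) (hl : LevelLT n l) {b : Letter × ℕ} {j : ℕ} (hj : 1 ≤ j)
    (hb : j ≤ r b) : IsTail p S R c n (l + (r - Finsupp.single b j)) := by
  have hle : ∀ a, n ≤ a.2 → (l + (r - Finsupp.single b j)) a ≤ r a := fun a ha => by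
    rw [Finsupp.add_apply, hl a ha, zero_add]
    exact Nat.sub_le _ _
  refine ⟨fun a ha => ?_, fun a h1 h2 => ?_, Or.inl ?_⟩
  · have := hle a (by omega)
    rw [hr.level a ha] at this
    omega
  · have := hle (a, n) le_rfl
    rw [hr.third a h1 h2] at this
    omega
  · have h1 := hle (c, n) le_rfl
    have h2 := hle (partner c, n) le_rfl
    have h3 := hr.le
    rcases hr.deficient with h | h
    · omega
    · have hlt : ∀ a, a.2 = n → b = a → (l + (r - Finsupp.single b j)) a < r a := by
        rintro a ha rfl
        rw [Finsupp.add_apply, hl b ha.ge, zero_add, Finsupp.tsub_apply, Finsupp.single_eq_same]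
        omega
      by_cases hc : b = (c, n)
      · have := hlt (c, n) rfl hc
        omega
      · by_cases hc' : b = (partner c, n)
        · have := hlt (partner c, n) rfl hc'
          omega
        · rw [h, topExp_apply_of_ne c n b hc hc'] at hb
          omega

end Tails

end Clover

/-! ### The weight filtration and its stability under brackets and p-th powers -/

namespace Clover

open DPAlg

section Filtration

variable (K : Type*) [Field K] (p : ℕ) [hp : Fact p.Prime] [CharP K p] (S R : ℕ → ℕ)

/-- The powers of partial derivatives of weight at most `m`. -/
noncomputable def partialSet (m : ℕ) : Set (Derivation K (Alg K p S R) (Alg K p S R)) :=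
  {D | ∃ (b : Letter × ℕ) (k : ℕ), p ^ k * pivotWeight p S R b.2 ≤ m ∧ D = partialPow b k}

/-- The standard monomials of weight at most `m`. -/
noncomputable def tailSet (m : ℕ) : Set (Derivation K (Alg K p S R) (Alg K p S R)) :=
  {D | ∃ (c : Letter) (n : ℕ) (r : Letter × ℕ →₀ ℕ), IsTail p S R c n r ∧ r ≠ 0 ∧
    (∀ a, r a < p ^ bound S R a) ∧ pivotWeight p S R (n + 1) ≤ m + weight p S R r ∧
    D = (mono r : Alg K p S R) • pivot K p S R c (n + 1)}

/-- A filtration on a restricted Lie algebra that contains the clover Lie algebra. -/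
noncomputable def filt (m : ℕ) : Submodule K (Derivation K (Alg K p S R) (Alg K p S R)) :=
  Submodule.span K (partialSet K p S R m ∪ tailSet K p S R m)

variable {K p S R}

theorem filt_mono {m m' : ℕ} (h : m ≤ m') : filt K p S R m ≤ filt K p S R m' := by
  refine Submodule.span_mono (Set.union_subset_union ?_ ?_)
  · rintro D ⟨b, k, h', rfl⟩
    exact ⟨b, k, h'.trans h, rfl⟩
  · rintro D ⟨c, n, r, h1, h2, h3, h4, rfl⟩
    exact ⟨c, n, r, h1, h2, h3, by omega, rfl⟩

theorem partialPow_mem_filt {m : ℕ} (b : Letter × ℕ) (k : ℕ)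
    (h : p ^ k * pivotWeight p S R b.2 ≤ m) : partialPow b k ∈ filt K p S R m :=
  Submodule.subset_span (Or.inl ⟨b, k, h, rfl⟩)

theorem pivot_mem_filt (hS : ∀ n, 1 ≤ S n) {m : ℕ} (c : Letter) (n : ℕ)
    (h : pivotWeight p S R n ≤ m) : pivot K p S R c n ∈ filt K p S R m := by
  rw [pivot_eq]
  refine add_mem (partialPow_mem_filt (c, n) 0 (by rwa [pow_zero, one_mul])) ?_
  refine Submodule.subset_span (Or.inr ⟨c, n, _, isTail_topExp c n, topExp_ne_zero hS c n,
    topExp_lt c n, ?_, rfl⟩)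
  rw [← weight_topExp c n]
  omega

/-- The generators in `tailSet` exclude r = 0, so that their p-th powers vanish, and exclude
exponents out of range. Both cases are harmless: the first gives a pivot, the second gives zero. -/
theorem tail_mem_filt (hS : ∀ n, 1 ≤ S n) {m : ℕ} {c : Letter} {n : ℕ} {r : Letter × ℕ →₀ ℕ}
    (hr : IsTail p S R c n r) (h : pivotWeight p S R (n + 1) ≤ m + weight p S R r) :
    (mono r : Alg K p S R) • pivot K p S R c (n + 1) ∈ filt K p S R m := by
  by_cases h0 : r = 0
  · subst h0
    rw [weight, Finsupp.sum_zero_index, add_zero] at h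
    have : (mono 0 : Alg K p S R) = 1 := rfl
    rw [this, one_smul]
    exact pivot_mem_filt hS c (n + 1) h
  · by_cases hb : ∀ a, r a < p ^ bound S R a
    · exact Submodule.subset_span (Or.inr ⟨c, n, r, hr, h0, hb, h, rfl⟩)
    · rw [mono_eq_zero r hb, zero_smul]
      exact zero_mem _

/-- Membership of `(l * d) • pivot c (n + 1)`, where `d` is obtained from a tail by a power of a partial
derivative and `l` has lower level. -/
theorem lower_mem_filt (hS : ∀ n, 1 ≤ S n) {m : ℕ} {c : Letter} {n : ℕ} {r l : Letter × ℕ →₀ ℕ}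
    (hr : IsTail p S R c n r) (hrb : ∀ a, r a < p ^ bound S R a) (hl : LevelLT n l)
    (b : Letter × ℕ) (k : ℕ)
    (h : pivotWeight p S R (n + 1) + p ^ k * pivotWeight p S R b.2
      ≤ m + weight p S R l + weight p S R r) :
    ((mono l * partialPow b k (mono r) : Alg K p S R)) • pivot K p S R c (n + 1)
      ∈ filt K p S R m := by
  rw [partialPow_mono b k r hrb]
  split_ifs with hk
  · obtain ⟨d, hd⟩ := exists_mono_mul_mono (K := K) (p := p) (s := bound S R) l
      (r - Finsupp.single b (p ^ k))
    rw [hd, smul_assoc]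
    refine Submodule.smul_mem _ _ (tail_mem_filt hS
      (hr.add_sub_single hl (Nat.one_le_pow _ _ hp.out.pos) hk) ?_)
    have := weight_sub_single (p := p) (S := S) (R := R) r b _ hk
    rw [weight_add]
    omega
  · rw [mul_zero, zero_smul]
    exact zero_mem _

theorem mono_smul_pivot {n : ℕ} {r : Letter × ℕ →₀ ℕ} (hr : LevelLT n r) (c : Letter) :
    (mono r : Alg K p S R) • pivot K p S R c n
      = (mono r : Alg K p S R) • partialD (c, n)
        + (mono (r + topExp p S R c n) : Alg K p S R) • pivot K p S R c (n + 1) := by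
  rw [pivot_eq c n, smul_add, smul_smul, mono_mul_topExp hr]

/-- The power of ∂_b sees nothing below its own level, so the pivot is unfolded k times until level
b.2 is reached. There it strikes `topExp` and produces a deficient tail of the right weight. The
product with r need not be a tail before that. -/
theorem partialPow_lie_mono_smul_pivot_of_le (hS : ∀ n, 1 ≤ S n) (b : Letter × ℕ) (i : ℕ)
    (c : Letter) {q : ℕ} (k : ℕ) : ∀ (n : ℕ) (r : Letter × ℕ →₀ ℕ), n + k = b.2 → LevelLT n r →
      p ^ i * pivotWeight p S R b.2 + pivotWeight p S R n ≤ q + weight p S R r →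
      ⁅(partialPow b i : Derivation K (Alg K p S R) (Alg K p S R)),
        (mono r : Alg K p S R) • pivot K p S R c n⁆ ∈ filt K p S R q := by
  induction k with
  | zero =>
    intro n r hn hr hq
    rw [add_zero] at hn
    rw [Derivation.lie_smul_derivation, partialPow_mono_eq_zero b i r (hr b hn.le), zero_smul,
      zero_add, pivot_eq, lie_add, partialPow_lie_partialD, zero_add,
      Derivation.lie_smul_derivation, partialPow_lie_pivot b i c (n + 1) (by omega), smul_zero,
      add_zero, smul_smul]
    refine lower_mem_filt hS (isTail_topExp c n) (topExp_lt c n) hr b i ?_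
    have := weight_topExp (p := p) (S := S) (R := R) c n
    omega
  | succ k ih =>
    intro n r hn hr hq
    have hr0 : partialPow b i (mono r : Alg K p S R) = 0 :=
      partialPow_mono_eq_zero b i r (hr b (by omega))
    have := weight_topExp (p := p) (S := S) (R := R) c n
    have h1 := ih (n + 1) (r + topExp p S R c n) (by omega)
      ((hr.mono n.le_succ).add (levelLT_topExp c n)) (by rw [weight_add]; omega)
    rw [mono_smul_pivot hr, lie_add, Derivation.lie_smul_derivation, hr0, zero_smul, zero_add,
      partialPow_lie_partialD, smul_zero, zero_add]
    exact h1

theorem partialPow_lie_tail (hS : ∀ n, 1 ≤ S n) (b : Letter × ℕ) (i : ℕ) {c : Letter} {n q : ℕ}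
    {r : Letter × ℕ →₀ ℕ} (hr : IsTail p S R c n r) (hrb : ∀ a, r a < p ^ bound S R a)
    (h : p ^ i * pivotWeight p S R b.2 + pivotWeight p S R (n + 1) ≤ q + weight p S R r) :
    ⁅(partialPow b i : Derivation K (Alg K p S R) (Alg K p S R)),
      (mono r : Alg K p S R) • pivot K p S R c (n + 1)⁆ ∈ filt K p S R q := by
  rcases Nat.lt_or_ge b.2 (n + 1) with hb | hb
  · rw [Derivation.lie_smul_derivation, partialPow_lie_pivot b i c (n + 1) hb, smul_zero, add_zero]
    have := lower_mem_filt (K := K) (l := 0) (m := q) hS hr hrb (fun _ _ => rfl) b i (by omega)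
    have e : (mono 0 : Alg K p S R) = 1 := rfl
    rwa [e, one_mul] at this
  · exact partialPow_lie_mono_smul_pivot_of_le hS b i c (b.2 - (n + 1)) (n + 1) r (by omega)
      hr.level h

/-- Unfold the pivot of lower level, k levels below the other one. Each partial split off lowers the
exponent r', leaving a deficient tail; the remainder moves up one level with the same weight. At
equal levels `pivot_lie_pivot` yields tails one level higher. -/
theorem mono_smul_pivot_lie_tail (hS : ∀ n, 1 ≤ S n) (c : Letter) {c' : Letter} {m q : ℕ}
    {r' : Letter × ℕ →₀ ℕ} (hr' : IsTail p S R c' m r') (hrb : ∀ a, r' a < p ^ bound S R a)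
    (k : ℕ) : ∀ (n : ℕ) (r : Letter × ℕ →₀ ℕ), n + k = m + 1 → LevelLT n r →
      pivotWeight p S R n + pivotWeight p S R (m + 1) ≤ q + weight p S R r + weight p S R r' →
      ⁅(mono r : Alg K p S R) • pivot K p S R c n,
        (mono r' : Alg K p S R) • pivot K p S R c' (m + 1)⁆ ∈ filt K p S R q := by
  induction k with
  | zero =>
    intro n r hn hr hq
    obtain rfl : n = m + 1 := by omega
    obtain ⟨d, hd⟩ := exists_mono_mul_mono (K := K) (p := p) (s := bound S R) r r'
    have hlow : ∀ c₁ c₂ : Letter, ((mono r * mono r' : Alg K p S R) *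
        partialD (c₁, m + 1) (mono (topExp p S R c₂ (m + 1)))) • pivot K p S R c₂ (m + 1 + 1)
          ∈ filt K p S R q := fun c₁ c₂ => by
      rw [hd, smul_mul_assoc, smul_assoc]
      refine Submodule.smul_mem _ _ ?_
      refine lower_mem_filt hS (isTail_topExp c₂ (m + 1)) (topExp_lt c₂ (m + 1))
        (hr.add hr'.level) (c₁, m + 1) 0 ?_
      have := weight_topExp (p := p) (S := S) (R := R) c₂ (m + 1)
      rw [weight_add, pow_zero, one_mul]
      change _ + pivotWeight p S R (m + 1) ≤ _
      omega
    rw [Derivation.smul_derivation_lie, Derivation.lie_smul_derivation,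
      pivot_mono_eq_zero c (m + 1) r' hr'.level, Derivation.smul_apply,
      pivot_mono_eq_zero c' (m + 1) r hr, pivot_lie_pivot hS, zero_smul, zero_add, smul_zero,
      zero_smul, sub_zero, smul_smul, smul_sub, smul_smul, smul_smul]
    exact sub_mem (hlow c c') (hlow c' c)
  | succ k ih =>
    intro n r hn hr hq
    have := weight_topExp (p := p) (S := S) (R := R) c n
    have h1 := ih (n + 1) (r + topExp p S R c n) (by omega)
      ((hr.mono n.le_succ).add (levelLT_topExp c n)) (by rw [weight_add]; omega)
    rw [mono_smul_pivot hr, add_lie]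
    refine add_mem ?_ h1
    rw [Derivation.smul_derivation_lie, Derivation.lie_smul_derivation,
      partialD_lie_pivot (c, n) c' (m + 1) (by change n < _; omega), Derivation.smul_apply,
      pivot_mono_eq_zero c' (m + 1) r (hr.mono (by omega)), smul_zero, smul_zero, zero_smul,
      sub_zero, add_zero, smul_smul]
    refine lower_mem_filt hS hr' hrb (hr.mono (by omega)) (c, n) 0 ?_
    rw [pow_zero, one_mul]
    change _ + pivotWeight p S R n ≤ _
    omega

theorem lie_mem_filt (hS : ∀ n, 1 ≤ S n) {m m' : ℕ}
    {D E : Derivation K (Alg K p S R) (Alg K p S R)} (hD : D ∈ filt K p S R m)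
    (hE : E ∈ filt K p S R m') : ⁅D, E⁆ ∈ filt K p S R (m + m') := by
  induction hD using Submodule.span_induction with
  | zero => rw [zero_lie]; exact zero_mem _
  | add x y _ _ hx hy => rw [add_lie]; exact add_mem hx hy
  | smul a x _ hx => rw [smul_lie]; exact Submodule.smul_mem _ _ hx
  | mem D hD =>
    induction hE using Submodule.span_induction with
    | zero => rw [lie_zero]; exact zero_mem _
    | add x y _ _ hx hy => rw [lie_add]; exact add_mem hx hy
    | smul a x _ hx => rw [lie_smul]; exact Submodule.smul_mem _ _ hx
    | mem E hE =>
      rcases hD with ⟨b, i, hb, rfl⟩ | ⟨c, n, r, hr, -, hrb, hw, rfl⟩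
      · rcases hE with ⟨b', i', hb', rfl⟩ | ⟨c', n', r', hr', -, hrb', hw', rfl⟩
        · rw [partialPow_lie_partialPow]
          exact zero_mem _
        · exact partialPow_lie_tail hS b i hr' hrb' (by omega)
      · rcases hE with ⟨b', i', hb', rfl⟩ | ⟨c', n', r', hr', -, hrb', hw', rfl⟩
        · rw [← lie_skew]
          exact neg_mem (partialPow_lie_tail hS b' i' hr hrb (by omega))
        · rcases le_total n n' with h | h
          · exact mono_smul_pivot_lie_tail hS c hr' hrb' (n' - n) (n + 1) r (by omega) hr.level
              (by omega)
          · rw [← lie_skew]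
            exact neg_mem (mono_smul_pivot_lie_tail hS c' hr hrb (n - n') (n' + 1) r' (by omega)
              hr'.level (by omega))

/-- On generators the p-mapping raises the power of a partial or kills a tail, whose monomial is a
constant for its pivot and has p-th power zero. Jacobson's formula extends this to sums. -/
theorem pMap_mem_filt (hS : ∀ n, 1 ≤ S n) {m : ℕ} {D : Derivation K (Alg K p S R) (Alg K p S R)}
    (hD : D ∈ filt K p S R m) : Derivation.pMap p D ∈ filt K p S R (m * p) := by
  have hp0 : p ≠ 0 := hp.out.ne_zero
  induction hD using Submodule.span_induction with
  | zero =>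
    have : Derivation.pMap p (0 : Derivation K (Alg K p S R) (Alg K p S R)) = 0 := by
      ext f
      rw [Derivation.pMap_apply, Derivation.coe_zero_linearMap, zero_pow hp0]
      rfl
    rw [this]
    exact zero_mem _
  | add x y hx hy hx' hy' =>
    -- After p−1 brackets the index is p·m, exactly the target weight.
    have key := Derivation.pMap_add_sub_mem (p := p) (fun k => filt K p S R ((k + 1) * m))
      (D := x) (E := y) (by rwa [zero_add, one_mul])
      (fun k z hz => by
        have := lie_mem_filt hS hx hz
        rwa [show m + (k + 1) * m = (k + 1 + 1) * m by ring] at this)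
      (fun k z hz => by
        have := lie_mem_filt hS hy hz
        rwa [show m + (k + 1) * m = (k + 1 + 1) * m by ring] at this)
    simp only [Nat.sub_add_cancel hp.out.one_le, mul_comm p m] at key
    have := add_mem (add_mem key hx') hy'
    rwa [show ∀ a b c : Derivation K (Alg K p S R) (Alg K p S R), a - b - c + b + c = a from
      fun a b c => by abel] at this
  | smul a x _ hx =>
    rw [Derivation.pMap_const_smul]
    exact Submodule.smul_mem _ _ hx
  | mem D hD =>
    rcases hD with ⟨b, i, hb, rfl⟩ | ⟨c, n, r, hr, h0, hrb, hw, rfl⟩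
    · have : Derivation.pMap p (partialPow b i : Derivation K (Alg K p S R) (Alg K p S R))
          = partialPow b (i + 1) := (Function.iterate_succ_apply' _ _ _).symm
      rw [this]
      refine partialPow_mem_filt b (i + 1) ?_
      rw [pow_succ, mul_right_comm]
      exact Nat.mul_le_mul_right p hb
    · rw [Derivation.pMap_smul_eq_zero _ _ (pivot_mono_eq_zero c (n + 1) r hr.level)
        (mono_pow_prime r h0)]
      exact zero_mem _

theorem pMap_iterate_mem_filt (hS : ∀ n, 1 ≤ S n) {m : ℕ}
    {D : Derivation K (Alg K p S R) (Alg K p S R)} (hD : D ∈ filt K p S R m) (k : ℕ) :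
    (Derivation.pMap p)^[k] D ∈ filt K p S R (m * p ^ k) := by
  induction k with
  | zero => simpa using hD
  | succ k ih =>
    rw [Function.iterate_succ_apply', pow_succ, ← mul_assoc]
    exact pMap_mem_filt hS ih

theorem rightNormed_mem_filt (hS : ∀ n, 1 ≤ S n) {m : ℕ}
    {X : Set (Derivation K (Alg K p S R) (Alg K p S R))} (hX : X ⊆ filt K p S R m)
    (l : List (Derivation K (Alg K p S R) (Alg K p S R))) (hl : ∀ x ∈ l, x ∈ X) :
    rightNormed l ∈ filt K p S R (m * l.length) := by
  induction l with
  | nil => exact zero_mem _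
  | cons x l ih =>
    have hx := hX (hl x List.mem_cons_self)
    cases l with
    | nil => simpa [rightNormed] using hx
    | cons y l =>
      have := lie_mem_filt hS hx (ih fun z hz => hl z (List.mem_cons_of_mem _ hz))
      rw [List.length_cons, Nat.mul_succ, add_comm]
      exact this

theorem growthSpace_le_filt (hS : ∀ n, 1 ≤ S n) {m : ℕ}
    {X : Set (Derivation K (Alg K p S R) (Alg K p S R))} (hX : X ⊆ filt K p S R m) (n : ℕ) :
    growthSpace K p X n ≤ filt K p S R (m * n) := by
  refine Submodule.span_le.mpr ?_
  rintro D ⟨l, k, -, hl, hn, rfl⟩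
  refine filt_mono ?_ (pMap_iterate_mem_filt hS (rightNormed_mem_filt hS hX l hl) k)
  rw [mul_assoc]
  exact Nat.mul_le_mul_left m hn

/-- The union of the filtration. -/
noncomputable def filtUnion (hS : ∀ n, 1 ≤ S n) :
    LieSubalgebra K (Derivation K (Alg K p S R) (Alg K p S R)) where
  carrier := {D | ∃ m, D ∈ filt K p S R m}
  zero_mem' := ⟨0, zero_mem _⟩
  add_mem' := by
    rintro D E ⟨m, hD⟩ ⟨m', hE⟩
    exact ⟨m + m', add_mem (filt_mono (Nat.le_add_right _ _) hD)
      (filt_mono (Nat.le_add_left _ _) hE)⟩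
  smul_mem' := by
    rintro c D ⟨m, hD⟩
    exact ⟨m, Submodule.smul_mem _ _ hD⟩
  lie_mem' := by
    rintro D E ⟨m, hD⟩ ⟨m', hE⟩
    exact ⟨m + m', lie_mem_filt hS hD hE⟩

theorem exists_mem_filt (hS : ∀ n, 1 ≤ S n) {D : Derivation K (Alg K p S R) (Alg K p S R)}
    (hD : D ∈ T K p S R) : ∃ m, D ∈ filt K p S R m := by
  refine (mem_lieP _ _).mp hD (filtUnion hS) ?_ fun E hE => ?_
  · have h : ∀ c, pivot K p S R c 0 ∈ (filtUnion hS : LieSubalgebra K _) := fun c =>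
      ⟨_, pivot_mem_filt hS c 0 le_rfl⟩
    rintro D (rfl | rfl | rfl)
    · rw [v_eq_pivot]; exact h _
    · rw [w_eq_pivot]; exact h _
    · rw [u_eq_pivot]; exact h _
  · obtain ⟨m, hm⟩ := hE
    exact ⟨m * p, pMap_mem_filt hS hm⟩

theorem exists_subset_filt (hS : ∀ n, 1 ≤ S n)
    {X : Set (Derivation K (Alg K p S R) (Alg K p S R))} (hX : X.Finite)
    (hXT : X ⊆ T K p S R) : ∃ m, X ⊆ filt K p S R m := by
  induction X, hX using Set.Finite.induction_on with
  | empty => exact ⟨0, Set.empty_subset _⟩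
  | @insert D X _ _ ih =>
    obtain ⟨m, hm⟩ := ih ((Set.subset_insert _ _).trans hXT)
    obtain ⟨m', hm'⟩ := exists_mem_filt hS (hXT (Set.mem_insert _ _))
    refine ⟨m + m', Set.insert_subset (filt_mono (Nat.le_add_left _ _) hm') fun E hE => ?_⟩
    exact filt_mono (Nat.le_add_right _ _) (hm hE)

end Filtration

end Clover

/-! ### Counting the tails of bounded weight -/

theorem mixed_radix_injective {A c : ℕ → ℕ} (hA0 : A 0 = 1) (hA : ∀ j, A (j + 1) = A j * c j)
    (n : ℕ) : ∀ {d d' : ℕ → ℕ} {e e' : ℕ}, (∀ j < n, d j < c j) → (∀ j < n, d' j < c j) →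
      ∑ j ∈ Finset.range n, d j * A j + e * A n = ∑ j ∈ Finset.range n, d' j * A j + e' * A n →
      e = e' ∧ ∀ j < n, d j = d' j := by
  induction n with
  | zero => intro d d' e e' _ _ h; simpa [hA0] using h
  | succ n ih =>
    intro d d' e e' hd hd' h
    have h1 : ∀ (d : ℕ → ℕ) (e : ℕ), ∑ j ∈ Finset.range (n + 1), d j * A j + e * A (n + 1)
        = ∑ j ∈ Finset.range n, d j * A j + (d n + c n * e) * A n := fun d e => by
      rw [Finset.sum_range_succ, hA]; ring
    rw [h1, h1] at h
    obtain ⟨h2, h3⟩ := ih (fun j hj => hd j (by omega)) (fun j hj => hd' j (by omega)) h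
    have hdn := hd n n.lt_succ_self
    have hdn' := hd' n n.lt_succ_self
    have h4 : d n = d' n := by
      have := congrArg (· % c n) h2
      simpa [Nat.mod_eq_of_lt hdn, Nat.mod_eq_of_lt hdn'] using this
    refine ⟨?_, fun j hj => ?_⟩
    · rw [h4] at h2
      exact Nat.eq_of_mul_eq_mul_left (by omega) (Nat.add_left_cancel h2)
    · rcases Nat.lt_succ_iff_lt_or_eq.mp hj with hj | rfl
      · exact h3 j hj
      · exact h4

namespace Clover

open DPAlg

/-- The letter that does not occur in the recursion of the pivot element of a given letter. -/
def third : Letter → Letter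
  | .x => .z
  | .y => .z
  | .z => .y

theorem third_ne (c : Letter) : third c ≠ c := by cases c <;> simp [third]

theorem third_ne_partner (c : Letter) : third c ≠ partner c := by cases c <;> simp [third, partner]

theorem eq_or_eq_partner_or_eq_third (c l : Letter) : l = c ∨ l = partner c ∨ l = third c := by
  cases c <;> cases l <;> simp [third, partner]

theorem sum_letter (c : Letter) (f : Letter → ℕ) : ∑ l, f l = f c + f (partner c) + f (third c) := by
  have : ∑ l, f l = f .x + (f .y + f .z) := by
    change ∑ l ∈ ({.x, .y, .z} : Finset Letter), f l = _
    rw [Finset.sum_insert (by simp), Finset.sum_pair (by simp)]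
  rw [this]
  cases c <;> simp only [third, partner] <;> omega

theorem card_letter : Fintype.card Letter = 3 := rfl

section Counting

variable (p : ℕ) (S R : ℕ → ℕ)

/-- The part of the defect of a monomial that comes from the letter `l` and the levels below `n`. -/
noncomputable def defect (r : Letter × ℕ →₀ ℕ) (n : ℕ) (l : Letter) : ℕ :=
  ∑ j ∈ Finset.range n, (p ^ bound S R (l, j) - 1 - r (l, j)) * pivotWeight p S R j

variable {p S R}

theorem sum_add_defect {r : Letter × ℕ →₀ ℕ} (hrb : ∀ a, r a < p ^ bound S R a) (n : ℕ)
    (l : Letter) : ∑ j ∈ Finset.range n, r (l, j) * pivotWeight p S R j + defect p S R r n l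
      = ∑ j ∈ Finset.range n, (p ^ bound S R (l, j) - 1) * pivotWeight p S R j := by
  rw [defect, ← Finset.sum_add_distrib]
  refine Finset.sum_congr rfl fun j _ => ?_
  have := hrb (l, j)
  rw [← add_mul]
  congr 1
  omega

theorem exists_codigits {c : Letter} {n : ℕ} {r : Letter × ℕ →₀ ℕ}
    (hrb : ∀ a, r a < p ^ bound S R a) :
    (p ^ bound S R (c, n) - 1 - r (c, n)) + (p ^ bound S R (partner c, n) - 1 - r (partner c, n))
      + (r (c, n) + r (partner c, n) + 2) = p ^ S n + p ^ R n := by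
  have h := pow_bound_add_partner (p := p) (S := S) (R := R) c n
  have h1 := hrb (c, n)
  have h2 := hrb (partner c, n)
  omega

theorem weight_eq_sum {n : ℕ} {r : Letter × ℕ →₀ ℕ} (hr : LevelLT n r) :
    weight p S R r = ∑ l, ∑ j ∈ Finset.range n, r (l, j) * pivotWeight p S R j := by
  have hsub : r.support ⊆ Finset.univ ×ˢ Finset.range n := fun a ha => by
    rw [Finset.mem_product, Finset.mem_range]
    refine ⟨Finset.mem_univ _, ?_⟩
    by_contra h
    exact Finsupp.mem_support_iff.mp ha (hr a (not_lt.mp h))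
  rw [weight, Finsupp.sum_of_support_subset r hsub (fun a e => e * pivotWeight p S R a.2)
    (fun _ _ => zero_mul _), Finset.sum_product]

variable [hp : Fact p.Prime]

theorem two_le_pow_of_one_le {e : ℕ} (he : 1 ≤ e) : 2 ≤ p ^ e :=
  hp.out.two_le.trans (Nat.le_self_pow (Nat.one_le_iff_ne_zero.mp he) p)

theorem two_pow_le_pivotWeight (hS : ∀ n, 1 ≤ S n) (hR : ∀ n, 1 ≤ R n) (n : ℕ) :
    2 ^ n ≤ pivotWeight p S R n := by
  induction n with
  | zero => simp [pivotWeight]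
  | succ n ih =>
    rw [pivotWeight_succ, pow_succ]
    have h1 := two_le_pow_of_one_le (p := p) (hS n)
    have h2 := two_le_pow_of_one_le (p := p) (hR n)
    exact Nat.mul_le_mul ih (by omega)

theorem two_le_pow_bound (hS : ∀ n, 1 ≤ S n) (hR : ∀ n, 1 ≤ R n) (a : Letter × ℕ) :
    2 ≤ p ^ bound S R a := by
  obtain ⟨l, n⟩ := a
  cases l
  exacts [two_le_pow_of_one_le (hS n), two_le_pow_of_one_le (hR n), two_le_pow_of_one_le (hR n)]

/-- A second copy of the x-terms turns the summand of level j into 2(p^{S_j} + p^{R_j} − 2)P_j =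
2(P_{j+1} − P_j), and the sum telescopes. -/
theorem sum_defect_add (n : ℕ) :
    ∑ l : Letter, ∑ j ∈ Finset.range n, (p ^ bound S R (l, j) - 1) * pivotWeight p S R j + 2
      + ∑ j ∈ Finset.range n, (p ^ S j - 1) * pivotWeight p S R j = 2 * pivotWeight p S R n := by
  induction n with
  | zero => simp [pivotWeight]
  | succ n ih =>
    rw [sum_letter .x] at ih ⊢
    simp only [Finset.sum_range_succ, pivotWeight_succ, third, partner, bound] at ih ⊢
    obtain ⟨P, hP⟩ := Nat.exists_eq_succ_of_ne_zero (pow_pos hp.out.pos (S n)).ne'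
    obtain ⟨Q, hQ⟩ := Nat.exists_eq_succ_of_ne_zero (pow_pos hp.out.pos (R n)).ne'
    rw [hP, hQ, show P.succ + Q.succ - 1 = P + Q + 1 by omega, Nat.succ_sub_one, Nat.succ_sub_one]
    linear_combination ih

theorem weight_add_sum_defect {c : Letter} {n : ℕ} {r : Letter × ℕ →₀ ℕ} (hr : IsTail p S R c n r)
    (hrb : ∀ a, r a < p ^ bound S R a) :
    weight p S R r + ∑ l, defect p S R r n l + 2
        + ∑ j ∈ Finset.range n, (p ^ S j - 1) * pivotWeight p S R j
      = (r (c, n) + r (partner c, n) + 2) * pivotWeight p S R n := by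
  have h1 : weight p S R r = ∑ l, ∑ j ∈ Finset.range n, r (l, j) * pivotWeight p S R j
      + (r (c, n) + r (partner c, n)) * pivotWeight p S R n := by
    rw [weight_eq_sum hr.level]
    simp only [Finset.sum_range_succ]
    rw [Finset.sum_add_distrib, ← Finset.sum_mul, sum_letter c (fun l => r (l, n)),
      hr.third _ (third_ne c) (third_ne_partner c), add_zero]
  have h2 := sum_defect_add (p := p) (S := S) (R := R) n
  simp only [← sum_add_defect hrb, Finset.sum_add_distrib] at h2
  rw [h1]
  linear_combination h2

/-- The complementary exponent of `a` in `r`. -/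
def codigit (p : ℕ) (S R : ℕ → ℕ) (r : Letter × ℕ →₀ ℕ) (a : Letter × ℕ) : ℕ :=
  p ^ bound S R a - 1 - r a

/-- Rewrites the weight condition in terms of missing exponents, where everything is nonnegative, so
each term is at most m separately. The defects control the lower levels letter by letter, t controls
level n, and the remaining x-sum controls n itself. -/
theorem tail_inequality {c : Letter} {n m : ℕ} {r : Letter × ℕ →₀ ℕ} (hr : IsTail p S R c n r)
    (hrb : ∀ a, r a < p ^ bound S R a)
    (hw : pivotWeight p S R (n + 1) ≤ m + weight p S R r) {t : ℕ}
    (ht : codigit p S R r (c, n) + codigit p S R r (partner c, n) = t + 1) :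
    t * pivotWeight p S R n + ∑ l, defect p S R r n l
      + ∑ j ∈ Finset.range n, (p ^ S j - 1) * pivotWeight p S R j ≤ m := by
  have h1 := weight_add_sum_defect hr hrb
  have h2 := exists_codigits (c := c) (n := n) hrb
  change codigit p S R r (c, n) + codigit p S R r (partner c, n) + _ = _ at h2
  rw [ht] at h2
  rw [pivotWeight_succ, ← h2,
    show t + 1 + (r (c, n) + r (partner c, n) + 2) - 1 = t + (r (c, n) + r (partner c, n) + 2) by
      omega, mul_add, mul_comm _ (r (c, n) + r (partner c, n) + 2), ← h1, mul_comm _ t] at hw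
  omega

/-- The index set of the standard monomials of weight at most `m`, except for the leading ones. -/
def deficientTails (p : ℕ) (S R : ℕ → ℕ) (m : ℕ) : Set (Letter × ℕ × (Letter × ℕ →₀ ℕ)) :=
  {q | IsTail p S R q.1 q.2.1 q.2.2 ∧ (∀ a, q.2.2 a < p ^ bound S R a) ∧
    pivotWeight p S R (q.2.1 + 1) ≤ m + weight p S R q.2.2 ∧
    q.2.2 (q.1, q.2.1) + q.2.2 (partner q.1, q.2.1) + 2 < p ^ S q.2.1 + p ^ R q.2.1}

/-- The encoding by which standard monomials are counted. -/
noncomputable def encode (p : ℕ) (S R : ℕ → ℕ) (q : Letter × ℕ × (Letter × ℕ →₀ ℕ)) :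
    Letter × ℕ × ℕ × ℕ × ℕ × ℕ :=
  let e := codigit p S R q.2.2 (q.1, q.2.1)
  let e' := codigit p S R q.2.2 (partner q.1, q.2.1)
  -- If the two missing exponents at level n sum to 1, then t = 0 in `tail_inequality` and P_n need
  -- not be bounded by a multiple of m. They are then omitted from the numbers and stored in the
  -- tag, e ∈ {0, 1}; the tag 2 marks the other case.
  let g := if e + e' = 1 then 0 else 1
  (q.1, q.2.1, if e + e' = 1 then e else 2,
    defect p S R q.2.2 q.2.1 q.1 + g * e * pivotWeight p S R q.2.1,
    defect p S R q.2.2 q.2.1 (partner q.1) + g * e' * pivotWeight p S R q.2.1,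
    defect p S R q.2.2 q.2.1 (third q.1))

/-- The missing exponents are digits for the place values P_j: each lies below the ratio P_{j+1}/P_j
= p^{S_j} + p^{R_j} − 1. The leading digit e may be arbitrary. -/
theorem defect_add_injective (hS : ∀ n, 1 ≤ S n) (hR : ∀ n, 1 ≤ R n) {r r' : Letter × ℕ →₀ ℕ}
    (hrb : ∀ a, r a < p ^ bound S R a) (hrb' : ∀ a, r' a < p ^ bound S R a) {n : ℕ} {l : Letter}
    {e e' : ℕ} (h : defect p S R r n l + e * pivotWeight p S R n
      = defect p S R r' n l + e' * pivotWeight p S R n) :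
    e = e' ∧ ∀ j < n, r (l, j) = r' (l, j) := by
  have hlt : ∀ (r : Letter × ℕ →₀ ℕ) (j : ℕ),
      p ^ bound S R (l, j) - 1 - r (l, j) < p ^ S j + p ^ R j - 1 := fun r j => by
    have h1 := two_le_pow_of_one_le (p := p) (hS j)
    have h2 := two_le_pow_of_one_le (p := p) (hR j)
    have h3 := pow_bound_add_partner (p := p) (S := S) (R := R) l j
    have h4 := two_le_pow_bound (p := p) hS hR (partner l, j)
    omega
  obtain ⟨h1, h2⟩ := mixed_radix_injective (A := pivotWeight p S R)
    (c := fun j => p ^ S j + p ^ R j - 1) rfl pivotWeight_succ n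
    (fun j _ => hlt r j) (fun j _ => hlt r' j) h
  refine ⟨h1, fun j hj => ?_⟩
  have := h2 j hj
  have := hrb (l, j)
  have := hrb' (l, j)
  omega

theorem encode_injOn (hS : ∀ n, 1 ≤ S n) (hR : ∀ n, 1 ≤ R n) (m : ℕ) :
    Set.InjOn (encode p S R) (deficientTails p S R m) := by
  rintro ⟨c, n, r⟩ ⟨hr, hrb, -, -⟩ ⟨c', n', r'⟩ ⟨hr', hrb', -, -⟩ h
  simp only [encode, Prod.mk.injEq] at h hr hr' hrb hrb'
  obtain ⟨rfl, rfl, ht, h1, h2, h3⟩ := h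
  obtain ⟨g1, h1⟩ := defect_add_injective hS hR hrb hrb' h1
  obtain ⟨g2, h2⟩ := defect_add_injective hS hR hrb hrb' h2
  obtain ⟨-, h3⟩ := defect_add_injective (e := 0) (e' := 0) hS hR hrb hrb' (by rw [h3])
  have he : codigit p S R r (c, n) = codigit p S R r' (c, n) ∧
      codigit p S R r (partner c, n) = codigit p S R r' (partner c, n) := by
    split_ifs at ht g1 g2 <;> omega
  have hcd : ∀ a, codigit p S R r a = codigit p S R r' a → r a = r' a := fun a h => by
    have := hrb a
    have := hrb' a
    unfold codigit at h
    omega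
  have : r = r' := by
    ext ⟨l, j⟩
    rcases lt_trichotomy j n with hj | rfl | hj
    · rcases eq_or_eq_partner_or_eq_third c l with rfl | rfl | rfl
      exacts [h1 j hj, h2 j hj, h3 j hj]
    · rcases eq_or_eq_partner_or_eq_third c l with rfl | rfl | rfl
      · exact hcd _ he.1
      · exact hcd _ he.2
      · rw [hr.third _ (third_ne c) (third_ne_partner c),
          hr'.third _ (third_ne c) (third_ne_partner c)]
    · rw [hr.level (l, j) hj, hr'.level (l, j) hj]
  rw [this]

/-- The range of the encoding. -/
def codes (m : ℕ) : Finset (Letter × ℕ × ℕ × ℕ × ℕ × ℕ) :=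
  Finset.univ ×ˢ Finset.range (Nat.log 2 m + 2) ×ˢ Finset.range 3 ×ˢ Finset.range (3 * (m + 1)) ×ˢ
    Finset.range (3 * (m + 1)) ×ˢ Finset.range (m + 1)

theorem card_codes (m : ℕ) : (codes m).card = 81 * ((Nat.log 2 m + 2) * (m + 1) ^ 3) := by
  simp only [codes, Finset.card_product, Finset.card_range, Finset.card_univ, card_letter]
  ring

theorem encode_mem_codes (hS : ∀ n, 1 ≤ S n) (hR : ∀ n, 1 ≤ R n) (m : ℕ) :
    Set.MapsTo (encode p S R) (deficientTails p S R m) (codes m) := by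
  rintro ⟨c, n, r⟩ ⟨hr, hrb, hw, hs⟩
  simp only at hr hrb hw hs
  have hcod := exists_codigits (c := c) (n := n) hrb
  change codigit p S R r (c, n) + codigit p S R r (partner c, n) + _ = _ at hcod
  obtain ⟨t, ht⟩ : ∃ t, codigit p S R r (c, n) + codigit p S R r (partner c, n) = t + 1 :=
    Nat.exists_eq_succ_of_ne_zero (by omega)
  have key := tail_inequality hr hrb hw ht
  rw [sum_letter c] at key
  -- The x-term of level n−1 alone is at least P_{n−1} ≥ 2^(n−1).
  have hn : n < Nat.log 2 m + 2 := by
    cases n with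
    | zero => omega
    | succ n =>
      rw [Finset.sum_range_succ] at key
      have h1 := two_le_pow_of_one_le (p := p) (hS n)
      have h2 : 1 * pivotWeight p S R n ≤ (p ^ S n - 1) * pivotWeight p S R n :=
        Nat.mul_le_mul_right _ (by omega)
      have h3 := two_pow_le_pivotWeight (p := p) hS hR n
      have := Nat.le_log_of_pow_le (b := 2) (by norm_num) (show 2 ^ n ≤ m by omega)
      omega
  -- For t ≥ 1 a single missing exponent is at most t + 1 ≤ 2t; for t = 0 the coefficient is
  -- switched off.
  have hg : ∀ e, e ≤ t + 1 → (if t + 1 = 1 then 0 else 1) * e * pivotWeight p S R n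
      ≤ 2 * (t * pivotWeight p S R n) := fun e he => by
    split_ifs with h
    · simp
    · rw [one_mul, ← mul_assoc]
      exact Nat.mul_le_mul_right _ (by omega)
  have hg1 := hg (codigit p S R r (c, n)) (by omega)
  have hg2 := hg (codigit p S R r (partner c, n)) (by omega)
  simp only [encode, codes, ht, Finset.coe_product, Set.mem_prod, Finset.mem_coe, Finset.mem_range,
    Finset.mem_univ, true_and]
  refine ⟨hn, ?_, by omega, by omega, by omega⟩
  split_ifs <;> omega

end Counting

/-! ### Dimension of the filtration -/

section Dimension

variable {K : Type*} [Field K] {p : ℕ} [hp : Fact p.Prime] [CharP K p] {S R : ℕ → ℕ}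

variable (K p S R) in
/-- The standard monomial with a given index. -/
noncomputable def tailDerivation (q : Letter × ℕ × (Letter × ℕ →₀ ℕ)) :
    Derivation K (Alg K p S R) (Alg K p S R) :=
  (mono q.2.2 : Alg K p S R) • pivot K p S R q.1 (q.2.1 + 1)

variable (K p S R) in
/-- A finite set that contains the powers of partial derivatives of weight at most `m`. -/
noncomputable def partialBox (m : ℕ) : Set (Derivation K (Alg K p S R) (Alg K p S R)) :=
  (fun q : Letter × ℕ × ℕ => partialPow (q.1, q.2.1) q.2.2) ''
    ((Finset.univ ×ˢ Finset.range (m + 1) ×ˢ Finset.range (m + 1) : Finset (Letter × ℕ × ℕ)) :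
      Set (Letter × ℕ × ℕ))

variable (K p S R) in
/-- A finite set that contains the leading standard monomials of weight at most `m`. -/
noncomputable def leadingBox (m : ℕ) : Set (Derivation K (Alg K p S R) (Alg K p S R)) :=
  (fun q : Letter × ℕ => tailDerivation K p S R (q.1, q.2, topExp p S R q.1 q.2)) ''
    ((Finset.univ ×ˢ Finset.range (m + 1) : Finset (Letter × ℕ)) : Set (Letter × ℕ))

theorem partialSet_subset (hS : ∀ n, 1 ≤ S n) (hR : ∀ n, 1 ≤ R n) (m : ℕ) :
    partialSet K p S R m ⊆ partialBox K p S R m := by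
  rintro D ⟨⟨l, n⟩, k, h, rfl⟩
  refine ⟨(l, n, k), ?_, rfl⟩
  have h1 := two_pow_le_pivotWeight (p := p) hS hR n
  have h2 : n < 2 ^ n := Nat.lt_two_pow_self
  have h3 : k < p ^ k := Nat.lt_pow_self hp.out.one_lt
  simp only at h
  have h4 : p ^ k * 1 ≤ p ^ k * pivotWeight p S R n := Nat.mul_le_mul_left _ (by omega)
  have h5 : 1 * pivotWeight p S R n ≤ p ^ k * pivotWeight p S R n :=
    Nat.mul_le_mul_right _ (by omega)
  simp only [Finset.coe_product, Set.mem_prod, Finset.mem_coe, Finset.mem_range,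
    Finset.mem_univ, true_and]
  omega

theorem tailSet_subset (hS : ∀ n, 1 ≤ S n) (hR : ∀ n, 1 ≤ R n) (m : ℕ) :
    tailSet K p S R m ⊆
      tailDerivation K p S R '' deficientTails p S R m ∪ leadingBox K p S R m := by
  rintro D ⟨c, n, r, hr, -, hrb, hw, rfl⟩
  rcases hr.deficient with h | rfl
  · exact Or.inl ⟨(c, n, r), ⟨hr, hrb, hw, h⟩, rfl⟩
  · refine Or.inr ⟨(c, n), ?_, rfl⟩
    have h1 := two_pow_le_pivotWeight (p := p) hS hR n
    have h2 : n < 2 ^ n := Nat.lt_two_pow_self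
    have h3 := weight_topExp (p := p) (S := S) (R := R) c n
    simp only [Finset.coe_product, Set.mem_prod, Finset.mem_coe, Finset.mem_range,
      Finset.mem_univ, true_and]
    omega

/-- The constant is 87 = 81 + 3 + 3, for the deficient tails, the powers of partials and the leading
tails. The last two families have only O(m²) and O(m) members. -/
theorem finite_and_ncard_le (hS : ∀ n, 1 ≤ S n) (hR : ∀ n, 1 ≤ R n) (m : ℕ) :
    (partialSet K p S R m ∪ tailSet K p S R m).Finite ∧
      (partialSet K p S R m ∪ tailSet K p S R m).ncard
        ≤ 87 * ((Nat.log 2 m + 2) * (m + 1) ^ 3) := by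
  have hdf : (deficientTails p S R m).Finite :=
    Set.Finite.of_injOn (encode_mem_codes hS hR m) (encode_injOn hS hR m) (codes m).finite_toSet
  have hdc : (deficientTails p S R m).ncard ≤ 81 * ((Nat.log 2 m + 2) * (m + 1) ^ 3) := by
    rw [← card_codes, ← Set.ncard_coe_finset]
    exact Set.ncard_le_ncard_of_injOn _ (encode_mem_codes hS hR m) (encode_injOn hS hR m)
      (codes m).finite_toSet
  have hsub := Set.union_subset_union (partialSet_subset (K := K) hS hR m)
    (tailSet_subset (K := K) hS hR m)
  have hfin : (partialBox K p S R m ∪ (tailDerivation K p S R '' deficientTails p S R m ∪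
      leadingBox K p S R m)).Finite :=
    ((Finset.finite_toSet _).image _).union
      ((hdf.image _).union ((Finset.finite_toSet _).image _))
  refine ⟨hfin.subset hsub, (Set.ncard_le_ncard hsub hfin).trans ?_⟩
  refine (Set.ncard_union_le _ _).trans ?_
  have h1 : (partialBox K p S R m).ncard ≤ 3 * ((m + 1) * (m + 1)) := by
    refine (Set.ncard_image_le (Finset.finite_toSet _)).trans (le_of_eq ?_)
    simp only [Set.ncard_coe_finset, Finset.card_product, Finset.card_range, Finset.card_univ,
      card_letter]
  have h2 := Set.ncard_image_le hdf (f := tailDerivation K p S R)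
  have h3 : (leadingBox K p S R m).ncard ≤ 3 * (m + 1) := by
    refine (Set.ncard_image_le (Finset.finite_toSet _)).trans (le_of_eq ?_)
    simp only [Set.ncard_coe_finset, Finset.card_product, Finset.card_range, Finset.card_univ,
      card_letter]
  have h4 := Set.ncard_union_le (tailDerivation K p S R '' deficientTails p S R m)
    (leadingBox K p S R m)
  have h5 : (m + 1) * (m + 1) ≤ (Nat.log 2 m + 2) * (m + 1) ^ 3 := by
    have : 1 * (m + 1) ^ 2 ≤ ((Nat.log 2 m + 2) * (m + 1)) * (m + 1) ^ 2 :=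
      Nat.mul_le_mul_right _ (Nat.mul_pos (by omega) (by omega))
    nlinarith
  have h6 : m + 1 ≤ (m + 1) * (m + 1) := Nat.le_mul_of_pos_left _ (by omega)
  omega

theorem finiteDimensional_filt (hS : ∀ n, 1 ≤ S n) (hR : ∀ n, 1 ≤ R n) (m : ℕ) :
    FiniteDimensional K (filt K p S R m) :=
  FiniteDimensional.span_of_finite K (finite_and_ncard_le hS hR m).1

theorem finrank_filt_le (hS : ∀ n, 1 ≤ S n) (hR : ∀ n, 1 ≤ R n) (m : ℕ) :
    Module.finrank K (filt K p S R m) ≤ 87 * ((Nat.log 2 m + 2) * (m + 1) ^ 3) := by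
  obtain ⟨hf, hc⟩ := finite_and_ncard_le (K := K) (p := p) hS hR m
  refine le_trans ?_ hc
  have := finrank_span_finset_le_card (R := K) hf.toFinset
  rw [Set.Finite.coe_toFinset, ← Set.ncard_eq_toFinset_card _ hf] at this
  exact this

end Dimension

end Clover

/-! ### Commutator chains that stabilize produce central elements -/

section LowerBound

theorem Commute.sub_pow_prime (K : Type*) [Field K] {B : Type*} [Ring B] [Algebra K B] {p : ℕ}
    [hp : Fact p.Prime] [CharP K p] {x y : B} (h : Commute x y) :
    (x - y) ^ p = x ^ p - y ^ p := by
  rcases subsingleton_or_nontrivial B with hB | hB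
  · exact Subsingleton.elim _ _
  · have := charP_of_injective_algebraMap (algebraMap K B).injective p
    exact sub_pow_char_of_commute p h

theorem exists_linearCombination_eq_zero {K V : Type*} [Field K] [AddCommGroup V] [Module K V]
    [FiniteDimensional K V] (φ : ℕ → V →ₗ[K] V) :
    ∃ c : ℕ →₀ K, c ≠ 0 ∧ ∑ i ∈ c.support, c i • φ i = 0 := by
  have hdep : ¬ LinearIndependent K φ := fun h => by
    have := h.finite
    exact not_finite ℕ
  rw [linearIndependent_iff] at hdep
  push Not at hdep
  obtain ⟨c, hc, hc0⟩ := hdep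
  exact ⟨c, hc0, hc⟩

variable {K : Type*} [Field K] {A : Type*} [CommRing A] [Algebra K A]

variable (K) in
/-- The span of the right-normed commutators of length at most `n` in `X`. -/
def commutatorSpan (X : Set (Derivation K A A)) (n : ℕ) : Submodule K (Derivation K A A) :=
  Submodule.span K {D | ∃ l : List (Derivation K A A), l ≠ [] ∧ (∀ x ∈ l, x ∈ X) ∧
    l.length ≤ n ∧ D = rightNormed l}

theorem commutatorSpan_mono (X : Set (Derivation K A A)) {m n : ℕ} (h : m ≤ n) :
    commutatorSpan K X m ≤ commutatorSpan K X n :=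
  Submodule.span_mono fun _ ⟨l, h1, h2, h3, h4⟩ => ⟨l, h1, h2, h3.trans h, h4⟩

theorem subset_commutatorSpan (X : Set (Derivation K A A)) (n : ℕ) :
    X ⊆ commutatorSpan K X (n + 1) := fun x hx =>
  Submodule.subset_span ⟨[x], by simp, by simpa using hx, by simp, rfl⟩

theorem lie_mem_commutatorSpan (X : Set (Derivation K A A)) (n : ℕ) {x y : Derivation K A A}
    (hx : x ∈ X) (hy : y ∈ commutatorSpan K X n) : ⁅x, y⁆ ∈ commutatorSpan K X (n + 1) := by
  induction hy using Submodule.span_induction with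
  | zero => rw [lie_zero]; exact zero_mem _
  | add y z _ _ hy hz => rw [lie_add]; exact add_mem hy hz
  | smul a y _ hy => rw [lie_smul]; exact Submodule.smul_mem _ _ hy
  | mem y hy =>
    obtain ⟨l, h1, h2, h3, rfl⟩ := hy
    obtain ⟨z, l, rfl⟩ := List.exists_cons_of_ne_nil h1
    refine Submodule.subset_span ⟨x :: z :: l, by simp, ?_, by simpa using h3, rfl⟩
    intro w hw
    rcases List.mem_cons.mp hw with rfl | hw
    exacts [hx, h2 w hw]

theorem le_finrank_commutatorSpan (X : Set (Derivation K A A))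
    (hfin : ∀ n, FiniteDimensional K (commutatorSpan K X n))
    (hne : ∀ n, commutatorSpan K X n ≠ commutatorSpan K X (n + 1)) (n : ℕ) :
    n ≤ Module.finrank K (commutatorSpan K X n) := by
  induction n with
  | zero => exact Nat.zero_le _
  | succ n ih =>
    have := hfin (n + 1)
    exact Nat.succ_le_of_lt (ih.trans_lt (Submodule.finrank_lt_finrank_of_lt
      (lt_of_le_of_ne (commutatorSpan_mono X n.le_succ) (hne n))))

variable {p : ℕ} [hp : Fact p.Prime] [CharP K p]

theorem commutatorSpan_le_growthSpace (X : Set (Derivation K A A)) (n : ℕ) :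
    commutatorSpan K X n ≤ growthSpace K p X n :=
  Submodule.span_mono fun _ ⟨l, h1, h2, h3, h4⟩ => ⟨l, 0, h1, h2, by simpa using h3, h4⟩

/-- Left and right multiplication by D commute, so ad(D)^p = (L − R)^p = L^p − R^p = ad(D^p) in
characteristic p. -/
theorem Derivation.pMap_lie (D E : Derivation K A A) :
    ⁅Derivation.pMap p D, E⁆ = (fun x : Derivation K A A => ⁅D, x⁆)^[p] E := by
  set L : Module.End K (Module.End K A) := LinearMap.mulLeft K (D : Module.End K A) with hL
  set M : Module.End K (Module.End K A) := LinearMap.mulRight K (D : Module.End K A) with hM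
  have hLM : Commute L M := LinearMap.commute_mulLeft_right _ _
  have hpow : (L - M) ^ p = L ^ p - M ^ p :=
    Commute.sub_pow_prime K (B := Module.End K (Module.End K A)) hLM
  have hiter : ∀ n, (((fun x : Derivation K A A => ⁅D, x⁆)^[n] E : Derivation K A A) :
      Module.End K A) = ((L - M) ^ n) (E : Module.End K A) := by
    intro n
    induction n with
    | zero => rfl
    | succ n ih =>
      rw [Function.iterate_succ_apply', pow_succ', Module.End.mul_apply, ← ih]
      exact Derivation.commutator_coe_linear_map
  have h := hiter p
  rw [hpow, hL, hM, LinearMap.pow_mulLeft, LinearMap.pow_mulRight] at h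
  ext a
  exact (LinearMap.congr_fun h a).symm

/-- The restricted subalgebra generated by `X` normalizes every subspace normalized by `X`. -/
theorem lie_mem_of_mem_lieP {X : Set (Derivation K A A)} {W : Submodule K (Derivation K A A)}
    (hW : ∀ x ∈ X, ∀ y ∈ W, ⁅x, y⁆ ∈ W) {D : Derivation K A A} (hD : D ∈ lieP K p X) :
    ∀ y ∈ W, ⁅D, y⁆ ∈ W := by
  let N : LieSubalgebra K (Derivation K A A) :=
    { carrier := {D | ∀ y ∈ W, ⁅D, y⁆ ∈ W}
      zero_mem' := fun y _ => by rw [zero_lie]; exact zero_mem _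
      add_mem' := fun hD hE y hy => by rw [add_lie]; exact add_mem (hD y hy) (hE y hy)
      smul_mem' := fun c D hD y hy => by rw [smul_lie]; exact Submodule.smul_mem _ _ (hD y hy)
      lie_mem' := fun hD hE y hy => by
        rw [lie_lie]; exact sub_mem (hD _ (hE y hy)) (hE _ (hD y hy)) }
  refine (mem_lieP _ _).mp hD N hW fun E hE y hy => ?_
  have h : ∀ n, (fun x : Derivation K A A => ⁅E, x⁆)^[n] y ∈ W := fun n => by
    induction n with
    | zero => exact hy
    | succ n ih => rw [Function.iterate_succ_apply']; exact hE _ ih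
  rw [Derivation.pMap_lie]
  exact h p

theorem lie_eq_zero_of_mem_lieP {X : Set (Derivation K A A)} {E : Derivation K A A}
    (hE : ∀ x ∈ X, ⁅x, E⁆ = 0) {D : Derivation K A A} (hD : D ∈ lieP K p X) : ⁅D, E⁆ = 0 := by
  let N : LieSubalgebra K (Derivation K A A) :=
    { carrier := {D | ⁅D, E⁆ = 0}
      zero_mem' := zero_lie _
      add_mem' := fun {D D'} (hD : ⁅D, E⁆ = 0) (hD' : ⁅D', E⁆ = 0) => by
        change ⁅D + D', E⁆ = 0
        rw [add_lie, hD, hD', add_zero]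
      smul_mem' := fun c D (hD : ⁅D, E⁆ = 0) => by
        change ⁅c • D, E⁆ = 0
        rw [smul_lie, hD, smul_zero]
      lie_mem' := fun {D D'} (hD : ⁅D, E⁆ = 0) (hD' : ⁅D', E⁆ = 0) => by
        change ⁅⁅D, D'⁆, E⁆ = 0
        rw [lie_lie, hD, hD', lie_zero, lie_zero, sub_zero] }
  exact (mem_lieP _ _).mp hD N hE fun F hF => Derivation.lie_pMap_eq_zero F E hF

/-- If the Lie algebra generated by `X` is finite-dimensional, then the restricted Lie algebra
generated by `X` is finite-dimensional modulo its center. -/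
theorem exists_central_combination {X : Set (Derivation K A A)}
    {W : Submodule K (Derivation K A A)} [FiniteDimensional K W] (hXW : X ⊆ W)
    (hW : ∀ x ∈ X, ∀ y ∈ W, ⁅x, y⁆ ∈ W) (e : ℕ → Derivation K A A) (he : ∀ i, e i ∈ lieP K p X) :
    ∃ c : ℕ →₀ K, c ≠ 0 ∧ ∀ E ∈ lieP K p X, ⁅E, Finsupp.linearCombination K e c⁆ = 0 := by
  have hN := fun i => lie_mem_of_mem_lieP hW (he i)
  let φ : ℕ → (W →ₗ[K] W) := fun i =>
    { toFun := fun y => ⟨⁅e i, (y : Derivation K A A)⁆, hN i y y.2⟩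
      map_add' := fun y z => Subtype.ext (lie_add _ _ _)
      map_smul' := fun a y => Subtype.ext (lie_smul _ _ _) }
  -- The infinitely many operators ad(e_i) on W are dependent in the finite-dimensional End W. The
  -- resulting combination kills W, in particular X, hence all of Lie_p(X).
  obtain ⟨c, hc0, hc⟩ := exists_linearCombination_eq_zero φ
  refine ⟨c, hc0, fun E hE => lie_eq_zero_of_mem_lieP (fun x hx => ?_) hE⟩
  have h1 := congrArg Subtype.val (LinearMap.congr_fun hc ⟨x, hXW hx⟩)
  rw [LinearMap.sum_apply] at h1
  rw [← lie_skew, neg_eq_zero, Finsupp.linearCombination_apply, Finsupp.sum, sum_lie]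
  simpa [φ] using h1

end LowerBound

/-! ### The pivots v_i, w_i lie in the clover algebra and the v_i are independent modulo its center
-/

namespace Clover

open DPAlg

/-- The letters x and y are partners of each other, so v and w have the same coefficients; the
hypothesis excludes z. -/
theorem topExp_partner {p : ℕ} {S R : ℕ → ℕ} {c : Letter} (hc : partner (partner c) = c) (n : ℕ) :
    topExp p S R (partner c) n = topExp p S R c n := by
  rw [topExp, topExp, hc, add_comm]

section PivotsInClover

variable {K : Type*} [Field K] {p : ℕ} [hp : Fact p.Prime] [CharP K p] {S R : ℕ → ℕ}

theorem pivot_apply_of_level (c : Letter) (n : ℕ) (r : Letter × ℕ →₀ ℕ) (hr : LevelLT (n + 1) r) :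
    pivot K p S R c n (mono r) = partialD (c, n) (mono r) := by
  rw [pivot_eq, Derivation.add_apply, Derivation.smul_apply,
    pivot_mono_eq_zero c (n + 1) r hr, smul_zero, add_zero]

theorem pivot_lie_pivot_of_lt (c d : Letter) {n i : ℕ} (h : n < i) :
    ⁅pivot K p S R c n, pivot K p S R d i⁆
      = (mono (topExp p S R c n) : Alg K p S R) • ⁅pivot K p S R c (n + 1), pivot K p S R d i⁆ := by
  rw [pivot_eq c n, add_lie, partialD_lie_pivot (c, n) d i h, zero_add,
    Derivation.smul_derivation_lie,
    pivot_mono_eq_zero d i _ ((levelLT_topExp c n).mono h), zero_smul, sub_zero]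

theorem pivot_lie_mono_smul_pivot (c d : Letter) (n : ℕ) (r : Letter × ℕ →₀ ℕ)
    (hr : LevelLT (n + 1) r) :
    ⁅pivot K p S R c n, (mono r : Alg K p S R) • pivot K p S R d (n + 1)⁆
      = (partialD (c, n) (mono r : Alg K p S R)) • pivot K p S R d (n + 1)
        + (mono r * mono (topExp p S R c n) : Alg K p S R)
          • ⁅pivot K p S R c (n + 1), pivot K p S R d (n + 1)⁆ := by
  rw [Derivation.lie_smul_derivation, pivot_apply_of_level c n r hr,
    pivot_lie_pivot_of_lt c d n.lt_succ_self, smul_smul]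

/-- The correction term of `pivot_lie_mono_smul_pivot` vanishes: either it brackets a pivot with
itself, or the top power of the partner variable occurs twice. -/
theorem pivot_lie_partialD_pow (hS : ∀ n, 1 ≤ S n) (hR : ∀ n, 1 ≤ R n) {c d : Letter} (n : ℕ)
    {r : Letter × ℕ →₀ ℕ} (hrb : ∀ a, r a < p ^ bound S R a) (hr : LevelLT (n + 1) r)
    (h : d = c ∨ r (partner c, n) = p ^ bound S R (partner c, n) - 1) (k : ℕ) :
    ⁅pivot K p S R c n, ((((partialD (c, n) : Derivation K (Alg K p S R) (Alg K p S R)) :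
        Alg K p S R →ₗ[K] Alg K p S R) ^ k) (mono r)) • pivot K p S R d (n + 1)⁆
      = ((((partialD (c, n) : Derivation K (Alg K p S R) (Alg K p S R)) :
        Alg K p S R →ₗ[K] Alg K p S R) ^ (k + 1)) (mono r)) • pivot K p S R d (n + 1) := by
  rw [pow_succ', Module.End.mul_apply, Derivation.coeFn_coe, partialD_pow_mono _ _ hrb]
  split_ifs with hk
  · rw [pivot_lie_mono_smul_pivot c d n _ fun a ha => ?_]
    · rw [add_eq_left]
      rcases h with rfl | h
      · rw [lie_self, smul_zero]
      · rw [mono_mul_mono_eq_zero _ _ (partner c, n), zero_smul]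
        have h1 := two_le_pow_bound (p := p) hS hR (partner c, n)
        have h2 : (partner c, n) ≠ (c, n) := fun h => partner_ne c (congrArg Prod.fst h)
        rw [Finsupp.tsub_apply, Finsupp.single_eq_of_ne h2, topExp_apply_partner, h]
        omega
    · rw [Finsupp.tsub_apply, hr a ha, Nat.zero_sub]
  · rw [zero_smul, lie_zero, map_zero, zero_smul]

/-- For c = x, say, apply ad(v_n) repeatedly to [v_n, w_n] = ∂_x(t)·w_{n+1} − ∂_y(t)·v_{n+1}. The
coefficient of w_{n+1} is one x-derivative ahead, so after p^{S_n} − 1 steps it is zero while the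
other has become y_n^(p^{R_n}−2). -/
theorem smul_pivot_mem (hS : ∀ n, 1 ≤ S n) (hR : ∀ n, 1 ≤ R n) {c : Letter}
    (hc : partner (partner c) = c) (n : ℕ)
    (L : LieSubalgebra K (Derivation K (Alg K p S R) (Alg K p S R)))
    (h1 : pivot K p S R c n ∈ L) (h2 : pivot K p S R (partner c) n ∈ L) :
    (mono (Finsupp.single (partner c, n) (p ^ bound S R (partner c, n) - 2)) : Alg K p S R)
      • pivot K p S R c (n + 1) ∈ L := by
  set δ : Module.End K (Alg K p S R) :=
    ((partialD (c, n) : Derivation K (Alg K p S R) (Alg K p S R)) :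
        Alg K p S R →ₗ[K] Alg K p S R) with hd
  set t := topExp p S R c n with ht
  set t' := t - Finsupp.single (partner c, n) 1 with ht'
  have hne : (c, n) ≠ (partner c, n) := fun h => partner_ne c (congrArg Prod.fst h).symm
  have hb := topExp_lt (p := p) (S := S) (R := R) c n
  have hb' : ∀ a, t' a < p ^ bound S R a := lt_of_sub_single _ _ hb
  have hl := levelLT_topExp (p := p) (S := S) (R := R) c n
  have hl' : LevelLT (n + 1) t' := fun a ha => by rw [ht', Finsupp.tsub_apply, hl a ha, Nat.zero_sub]
  have hP := two_le_pow_bound (p := p) hS hR (c, n)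
  have hQ := two_le_pow_bound (p := p) hS hR (partner c, n)
  have key : ∀ k : ℕ, ((δ ^ (k + 1)) (mono t)) • pivot K p S R (partner c) (n + 1)
      - ((δ ^ k) (mono t')) • pivot K p S R c (n + 1) ∈ L := by
    intro k
    induction k with
    | zero =>
      have := L.lie_mem h1 h2
      rw [pivot_lie_pivot hS, topExp_partner hc] at this
      rw [zero_add, pow_one, pow_zero, Module.End.one_apply, ht', ← partialD_of_ne _ _ hb]
      · exact this
      · rw [topExp_apply_partner]; omega
    | succ k ih =>
      have := L.lie_mem h1 ih
      rw [lie_sub, hd, pivot_lie_partialD_pow hS hR n hb hl (Or.inr (topExp_apply_partner c n)),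
        pivot_lie_partialD_pow hS hR n hb' hl' (Or.inl rfl)] at this
      exact this
  have h := key (p ^ bound S R (c, n) - 1)
  have e1 : t (c, n) = p ^ bound S R (c, n) - 1 := topExp_apply c n
  have e2 : t' (c, n) = p ^ bound S R (c, n) - 1 := by
    rw [ht', Finsupp.tsub_apply, Finsupp.single_eq_of_ne hne, e1, Nat.sub_zero]
  rw [hd, partialD_pow_mono _ _ hb, partialD_pow_mono _ _ hb', if_neg (by rw [e1]; omega),
    if_pos e2.ge, zero_smul, zero_sub, neg_mem_iff] at h
  have e3 : t' - Finsupp.single (c, n) (p ^ bound S R (c, n) - 1)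
      = Finsupp.single (partner c, n) (p ^ bound S R (partner c, n) - 2) := by
    rw [ht', ht, topExp, tsub_right_comm, add_tsub_cancel_left, ← Finsupp.single_tsub]
    congr 1
  rwa [e3] at h

theorem pivot_succ_mem (hS : ∀ n, 1 ≤ S n) (hR : ∀ n, 1 ≤ R n) {c : Letter}
    (hc : partner (partner c) = c) (n : ℕ)
    (L : LieSubalgebra K (Derivation K (Alg K p S R) (Alg K p S R)))
    (h1 : pivot K p S R c n ∈ L) (h2 : pivot K p S R (partner c) n ∈ L) :
    pivot K p S R c (n + 1) ∈ L := by
  have key : ∀ e : ℕ, e < p ^ bound S R (partner c, n) →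
      (mono (Finsupp.single (partner c, n) e) : Alg K p S R) • pivot K p S R c (n + 1) ∈ L →
      pivot K p S R c (n + 1) ∈ L := by
    intro e
    induction e with
    | zero =>
      intro _ h
      rw [Finsupp.single_zero] at h
      rwa [show (mono 0 : Alg K p S R) = 1 from rfl, one_smul] at h
    | succ e ih =>
      intro he h
      refine ih (by omega) ?_
      have h3 := L.lie_mem h2 h
      rw [pivot_lie_mono_smul_pivot _ _ _ _ fun a ha => Finsupp.single_eq_of_ne
        fun h => by rw [h] at ha; exact absurd ha (by simp)] at h3
      -- Bracketing with the partner pivot lowers the exponent by one. The correction term contains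
      -- the top power of the same variable times a positive power, so it is zero.
      rw [mono_mul_mono_eq_zero _ _ (partner c, n), zero_smul, add_zero, partialD_of_ne,
        ← Finsupp.single_tsub, Nat.add_sub_cancel] at h3
      · exact h3
      · intro b
        by_cases hb : b = (partner c, n)
        · rw [hb, Finsupp.single_eq_same]; exact he
        · rw [Finsupp.single_eq_of_ne hb]; exact pow_pos hp.out.pos _
      · simp
      · rw [Finsupp.single_eq_same, topExp_apply]
        omega
  have hQ := two_le_pow_bound (p := p) hS hR (partner c, n)
  exact key _ (by omega) (smul_pivot_mem hS hR hc n L h1 h2)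

theorem pivot_mem_T (hS : ∀ n, 1 ≤ S n) (hR : ∀ n, 1 ≤ R n) (n : ℕ) :
    pivot K p S R .x n ∈ T K p S R ∧ pivot K p S R .y n ∈ T K p S R := by
  induction n with
  | zero =>
    rw [← v_eq_pivot, ← w_eq_pivot]
    exact ⟨(mem_lieP _ _).mpr fun L h _ => h (Or.inl rfl),
      (mem_lieP _ _).mpr fun L h _ => h (Or.inr (Or.inl rfl))⟩
  | succ n ih =>
    exact ⟨pivot_succ_mem hS hR (c := .x) rfl n _ ih.1 ih.2,
      pivot_succ_mem hS hR (c := .y) rfl n _ ih.2 ih.1⟩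

/-- No nontrivial combination of the pivot elements `v_i` is central. -/
theorem eq_zero_of_lie_eq_zero (hS : ∀ n, 1 ≤ S n) (hR : ∀ n, 1 ≤ R n) (c : ℕ →₀ K)
    (h : ∀ m, ⁅pivot K p S R .y m,
      Finsupp.linearCombination K (fun i => pivot K p S R .x i) c⁆ = 0) : c = 0 := by
  by_contra hc
  have hne : c.support.Nonempty := Finsupp.support_nonempty_iff.mpr hc
  -- Let m be the least index that occurs, and consider x_m·[w_m, ·] evaluated at y_{m+1}. For i > m
  -- the bracket carries the factor t, and x_m·t = 0; for i = m the value is t ≠ 0. Hence the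
  -- coefficient at m vanishes.
  set m := c.support.min' hne with hm
  have hmem : m ∈ c.support := Finset.min'_mem _ _
  have hmin : ∀ i ∈ c.support, i ≠ m → m < i := fun i hi hi' =>
    lt_of_le_of_ne (Finset.min'_le _ _ hi) (Ne.symm hi')
  have hS2 := two_le_pow_of_one_le (p := p) (hS m)
  have hR2 := two_le_pow_of_one_le (p := p) (hR (m + 1))
  set t : Alg K p S R := mono (topExp p S R .x m) with ht
  set X : Alg K p S R := mono (Finsupp.single (.x, m) 1) with hX
  set Y : Alg K p S R := mono (Finsupp.single (.y, m + 1) 1) with hY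
  have hXb : ∀ b, (Finsupp.single (Letter.x, m) 1 : Letter × ℕ →₀ ℕ) b < p ^ bound S R b := by
    intro b
    by_cases hb : b = (.x, m)
    · rw [hb, Finsupp.single_eq_same]; exact hS2
    · rw [Finsupp.single_eq_of_ne hb]; exact pow_pos hp.out.pos _
  have hYb : ∀ b, (Finsupp.single (Letter.y, m + 1) 1 : Letter × ℕ →₀ ℕ) b
      < p ^ bound S R b := by
    intro b
    by_cases hb : b = (.y, m + 1)
    · rw [hb, Finsupp.single_eq_same]; exact hR2
    · rw [Finsupp.single_eq_of_ne hb]; exact pow_pos hp.out.pos _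
  have hXt : X * t = 0 := by
    refine mono_mul_mono_eq_zero _ _ (.x, m) ?_
    rw [Finsupp.single_eq_same, topExp_x]
    change p ^ S m ≤ _
    omega
  have hty : topExp p S R .y m = topExp p S R .x m := topExp_partner (c := .x) rfl m
  have hYl : LevelLT (m + 1 + 1) (Finsupp.single (Letter.y, m + 1) 1) := fun a ha =>
    Finsupp.single_eq_of_ne fun h => by rw [h] at ha; exact absurd ha (by simp)
  have hwY : pivot K p S R .y (m + 1) Y = 1 := by
    rw [pivot_apply_of_level _ _ _ hYl, partialD_of_ne _ _ hYb (by simp), tsub_self]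
    rfl
  have hvY : pivot K p S R .x (m + 1) Y = 0 := by
    rw [pivot_apply_of_level _ _ _ hYl]
    exact partialD_eq_zero _ _ (Finsupp.single_eq_of_ne (by simp))
  -- Differentiate x_m·t = 0.
  have hXd : X * partialD (.x, m) t = - t := by
    have h1 := congrArg (partialD (.x, m)) hXt
    have h2 : partialD (.x, m) X = 1 := by
      rw [hX, partialD_of_ne _ _ hXb (by simp), tsub_self]
      rfl
    rw [map_zero, Derivation.leibniz, h2, smul_eq_mul, smul_eq_mul, mul_one] at h1
    exact eq_neg_of_add_eq_zero_left h1
  have hlow : ∀ i, m < i → X * ⁅pivot K p S R .y m, pivot K p S R .x i⁆ Y = 0 := fun i hi => by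
    rw [pivot_lie_pivot_of_lt .y .x hi, Derivation.smul_apply, hty, smul_eq_mul, ← mul_assoc, hXt,
      zero_mul]
  have hmain : X * ⁅pivot K p S R .y m, pivot K p S R .x m⁆ Y = t := by
    rw [pivot_lie_pivot hS, Derivation.sub_apply, Derivation.smul_apply, Derivation.smul_apply,
      hvY, hwY, hty, smul_zero, zero_sub, smul_eq_mul, mul_one, mul_neg, hXd, neg_neg]
  have h0 := congrArg (fun D : Derivation K (Alg K p S R) (Alg K p S R) => X * D Y) (h m)
  simp only [Derivation.zero_apply, mul_zero] at h0
  rw [Finsupp.linearCombination_apply, Finsupp.sum, lie_sum] at h0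
  have hsum : ∀ s : Finset ℕ, X * (∑ i ∈ s, ⁅pivot K p S R .y m, c i • pivot K p S R .x i⁆) Y
      = ∑ i ∈ s, c i • (X * ⁅pivot K p S R .y m, pivot K p S R .x i⁆ Y) := fun s => by
    classical
    induction s using Finset.induction_on with
    | empty => simp
    | insert i s hi ih =>
      rw [Finset.sum_insert hi, Finset.sum_insert hi, Derivation.add_apply, mul_add, ih, lie_smul,
        Derivation.smul_apply, mul_smul_comm]
  rw [hsum, Finset.sum_eq_single m (fun i hi hi' => by rw [hlow i (hmin i hi hi'), smul_zero])
    (fun h => absurd hmem h), hmain] at h0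
  have ht0 : t ≠ 0 := by
    rw [ht, mono_eq_single _ (topExp_lt .x m)]
    exact Finsupp.single_ne_zero.mpr one_ne_zero
  exact (Finsupp.mem_support_iff.mp hmem) ((smul_eq_zero.mp h0).resolve_right ht0)

/-- If the commutator spans stopped growing at some step, a nontrivial combination of the v_i would
commute with every w_m. -/
theorem le_growth (hS : ∀ n, 1 ≤ S n) (hR : ∀ n, 1 ≤ R n)
    {X : Set (Derivation K (Alg K p S R) (Alg K p S R))}
    (hfin : ∀ n, FiniteDimensional K (growthSpace K p X n))
    (hgen : lieP K p X = T K p S R) (n : ℕ) : n ≤ growth K p X n := by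
  have hle := fun n => commutatorSpan_le_growthSpace (p := p) X n
  have hfin' : ∀ n, FiniteDimensional K (commutatorSpan K X n) := fun n =>
    have := hfin n
    Submodule.finiteDimensional_of_le (hle n)
  have := hfin n
  refine (le_finrank_commutatorSpan X hfin' (fun k hk => ?_) n).trans
    (Submodule.finrank_mono (hle n))
  have hXW : X ⊆ commutatorSpan K X k := by
    rw [hk]; exact subset_commutatorSpan X k
  have hW : ∀ x ∈ X, ∀ y ∈ commutatorSpan K X k, ⁅x, y⁆ ∈ commutatorSpan K X k :=
    fun x hx y hy => by
      have := lie_mem_commutatorSpan X k hx hy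
      rwa [← hk] at this
  have := hfin' k
  obtain ⟨c, hc, hcent⟩ := exists_central_combination (p := p) hXW hW
    (fun i => pivot K p S R .x i) (fun i => by rw [hgen]; exact (pivot_mem_T hS hR i).1)
  exact hc (eq_zero_of_lie_eq_zero hS hR c fun m => hcent _
    (by rw [hgen]; exact (pivot_mem_T hS hR m).2))

end PivotsInClover

end Clover

/-! ### From dimension bounds to the Gelfand-Kirillov dimension -/

namespace Clover

open Filter Topology

/-- The constant is 4176 = 87·6·2³. For n ≥ C the binary logarithm of Cn is at most 4·ln n, since ln
2 ≥ 1/2; for n ≥ 3 one has ln n ≥ 1, which absorbs the summand 2; and Cn + 1 ≤ 2Cn. -/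
theorem le_mul_pow_mul_log {C n : ℕ} (hC : 1 ≤ C) (hn : max C 3 ≤ n) {g : ℕ}
    (hg : g ≤ 87 * ((Nat.log 2 (C * n) + 2) * (C * n + 1) ^ 3)) :
    (g : ℝ) ≤ (4176 * C ^ 3 : ℝ) * (n ^ 3 * Real.log n) := by
  have hC' : (1 : ℝ) ≤ C := by exact_mod_cast hC
  have hCn : (C : ℝ) ≤ n := by exact_mod_cast (le_max_left _ _).trans hn
  have h3n : (3 : ℝ) ≤ n := by exact_mod_cast (le_max_right _ _).trans hn
  have hlogn : 1 ≤ Real.log n := by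
    rw [Real.le_log_iff_exp_le (by linarith)]
    exact (Real.exp_one_lt_d9.le.trans (by norm_num)).trans h3n
  have hlogC : Real.log C ≤ Real.log n := Real.log_le_log (by linarith) hCn
  have hlog2 : (1 / 2 : ℝ) ≤ Real.log 2 := by
    have := Real.log_two_gt_d9
    linarith
  have h1 : ((Nat.log 2 (C * n) : ℕ) : ℝ) ≤ 4 * Real.log n := by
    have h := Real.natLog_le_logb (C * n) 2
    refine h.trans ?_
    rw [Real.logb, div_le_iff₀ (by push_cast; linarith)]
    push_cast
    rw [Real.log_mul (by linarith) (by linarith)]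
    nlinarith
  have h2 : ((C : ℝ) * n + 1) ^ 3 ≤ (2 * (C * n)) ^ 3 := by
    have : (1 : ℝ) ≤ C * n := by nlinarith
    gcongr
    linarith
  have h3 : (g : ℝ) ≤ 87 * ((((Nat.log 2 (C * n) : ℕ) : ℝ) + 2) * ((C : ℝ) * n + 1) ^ 3) := by
    exact_mod_cast hg
  refine h3.trans ?_
  have h4 : (((Nat.log 2 (C * n) : ℕ) : ℝ) + 2) * ((C : ℝ) * n + 1) ^ 3
      ≤ (6 * Real.log n) * (2 * (C * n)) ^ 3 :=
    mul_le_mul (by linarith) h2 (by positivity) (by linarith)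
  refine (mul_le_mul_of_nonneg_left h4 (by norm_num)).trans (le_of_eq ?_)
  ring

/-- Dividing ln g ≤ ln B + 3·ln n + ln ln n by ln n leaves 3 in the limit. The lower bound on g only
ensures that its logarithm is taken at a positive number. -/
theorem limsup_log_div_log_le (g : ℕ → ℕ) (hg : ∀ n, n ≤ g n) {C : ℕ} (hC : 1 ≤ C)
    (hg' : ∀ n, g n ≤ 87 * ((Nat.log 2 (C * n) + 2) * (C * n + 1) ^ 3)) :
    limsup (fun n : ℕ => ((Real.log (g n) / Real.log n : ℝ) : EReal)) atTop ≤ 3 := by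
  set B : ℝ := 4176 * C ^ 3 with hB
  have hBpos : 0 < B := by
    have : (0 : ℝ) < C := by exact_mod_cast hC
    positivity
  have hlog : Tendsto (fun n : ℕ => Real.log n) atTop atTop :=
    Real.tendsto_log_atTop.comp tendsto_natCast_atTop_atTop
  have hlim : Tendsto (fun n : ℕ => Real.log B / Real.log n + (3 : ℝ)
      + Real.log (Real.log n) / Real.log n) atTop (𝓝 3) := by
    have h1 : Tendsto (fun n : ℕ => Real.log B / Real.log n) atTop (𝓝 0) :=
      hlog.const_div_atTop _
    have h2 : Tendsto (fun n : ℕ => Real.log (Real.log n) / Real.log n) atTop (𝓝 0) :=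
      Real.isLittleO_log_id_atTop.tendsto_div_nhds_zero.comp hlog
    simpa using (h1.add_const 3).add h2
  have hlimE := (continuous_coe_real_ereal.tendsto 3).comp hlim
  have h3 : ((3 : ℝ) : EReal) = 3 := rfl
  rw [h3] at hlimE
  rw [← hlimE.limsup_eq]
  refine limsup_le_limsup ?_
  filter_upwards [eventually_ge_atTop (max C 3)] with n hn
  have h3n : (3 : ℝ) ≤ n := by exact_mod_cast (le_max_right _ _).trans hn
  have hlogn : 1 ≤ Real.log n := by
    rw [Real.le_log_iff_exp_le (by linarith)]
    exact (Real.exp_one_lt_d9.le.trans (by norm_num)).trans h3n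
  have hgpos : (0 : ℝ) < g n := by
    have : (n : ℝ) ≤ g n := by exact_mod_cast hg n
    linarith
  have key : Real.log (g n) ≤ Real.log (B * (n ^ 3 * Real.log n)) :=
    Real.log_le_log hgpos (le_mul_pow_mul_log hC hn (hg' n))
  clear_value B
  rw [Real.log_mul hBpos.ne' (by positivity), Real.log_mul (by positivity) (by positivity),
    Real.log_pow] at key
  change ((_ : ℝ) : EReal) ≤ ((_ : ℝ) : EReal)
  rw [EReal.coe_le_coe_iff, div_le_iff₀ (by linarith), add_mul, add_mul,
    div_mul_cancel₀ _ (by linarith), div_mul_cancel₀ _ (by linarith)]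
  push_cast at key
  linarith

theorem le_limsup_log_div_log (g : ℕ → ℕ) (hg : ∀ n, n ≤ g n) :
    1 ≤ limsup (fun n : ℕ => ((Real.log (g n) / Real.log n : ℝ) : EReal)) atTop := by
  refine le_limsup_of_frequently_le (Eventually.frequently ?_)
  filter_upwards [eventually_ge_atTop 2] with n hn
  have h2n : (2 : ℝ) ≤ n := by exact_mod_cast hn
  have hlogn : 0 < Real.log n := Real.log_pos (by linarith)
  have hle : (n : ℝ) ≤ g n := by exact_mod_cast hg n
  rw [← EReal.coe_one, EReal.coe_le_coe_iff, one_le_div hlogn]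
  exact Real.log_le_log (by linarith) hle

end Clover

theorem theorem5p2 (K : Type*) [Field K] (p : ℕ) [Fact p.Prime] [CharP K p] (S R : ℕ → ℕ)
    (hS : ∀ n, 1 ≤ S n) (hR : ∀ n, 1 ≤ R n)
    (X : Set (Derivation K (Clover.Alg K p S R) (Clover.Alg K p S R))) (hX : X.Finite)
    (hgen : lieP K p X = Clover.T K p S R) :
    1 ≤ GKdim K p X ∧ GKdim K p X ≤ 3 := by
  have hXT : X ⊆ Clover.T K p S R := by
    rw [← hgen]
    exact fun D hD => (mem_lieP _ _).mpr fun L h _ => h hD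
  obtain ⟨C, hC⟩ := Clover.exists_subset_filt hS hX hXT
  -- The index is enlarged to C + 1 because the final estimate needs a constant of at least 1.
  have hle := Clover.growthSpace_le_filt hS (hC.trans (Clover.filt_mono (Nat.le_add_right C 1)))
  have hfd := fun m => Clover.finiteDimensional_filt (K := K) (p := p) hS hR m
  have hfin : ∀ n, FiniteDimensional K (growthSpace K p X n) := fun n =>
    have := hfd ((C + 1) * n)
    Submodule.finiteDimensional_of_le (hle n)
  have hlow : ∀ n, n ≤ growth K p X n := Clover.le_growth hS hR hfin hgen
  refine ⟨Clover.le_limsup_log_div_log _ hlow,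
    Clover.limsup_log_div_log_le _ hlow (C := C + 1) (Nat.le_add_left _ _) fun n => ?_⟩
  have := hfd ((C + 1) * n)
  exact (Submodule.finrank_mono (hle n)).trans (Clover.finrank_filt_le hS hR _)
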